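/- Let $J_x,J_y,J_z$ be the spin-$1$ angular momentum matrices $$J_x=-i\begin{pmatrix}0&0&0\\0&0&1\\0&-1&0\end{pmatrix},\quad J_y=-i\begin{pmatrix}0&0&-1\\0&0&0\\1&0&0\end{pmatrix},\quad J_z=-i\begin{pmatrix}0&1&0\\-1&0&0\\0&0&0\end{pmatrix},$$ let $\Lambda_1(\rho)=\tfrac12(J_x\rho J_x+J_y\rho J_y+J_z\rho J_z)$ be the Landau–Streater channel on $3\times 3$ complex matrices, $\Lambda_0=\mathrm{id}$, and for $0\le x\le 1$ let $\Lambda_x=(1-x)\Lambda_0+x\Lambda_1$. A quantum channel is a linear map $\Phi(X)=\sum_i K_iXK_i^\dagger$ with $\sum_iK_i^\dagger K_i=I$. A complementary channel of $\Phi:A\to B$ is a map $\Phi^c:A\to E$ for which there is an isometry $V:A\to B\otimes E$ with $\Phi(X)=\mathrm{tr}_E(VXV^\dagger)$ and $\Phi^c(X)=\mathrm{tr}_B(VXV^\dagger)$. $\Phi$ is degradable if $\mathcal N\circ\Phi=\Phi^c$ for some channel $\mathcal N$, and anti-degradable if $\mathcal M\circ\Phi^c=\Phi$ for some channel $\mathcal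 M$. With the von Neumann entropy $S(\rho)=-\mathrm{tr}\,\rho\log\rho$ (logarithms to base $2$), put $Q_1(\Phi)=\sup_\rho\,[S(\Phi(\rho))-S(\Phi^c(\rho))]$ over all density matrices $\rho$ (this does not depend on the choice of $\Phi^c$), and let $Q(\Phi)=\lim_{n\to\infty}\frac1nQ_1(\Phi^{\otimes n})$ be the (regularised) quantum capacity. Then, for every $x\in[0,1]$: 1. $\Lambda_x$ is a quantum channel, and $\Lambda_1(X)=\tfrac12(\mathrm{tr}(X)I-X^T)$ for all $X$. 2. $\Lambda_0$ and $\Lambda_1$ are degradable channels; $\Lambda_1$ is self-complementary ($\Lambda_1$ is a complementary channel of itself), hence also anti-degradable. 3. The supremum defining $Q_1(\Lambda_1)$ is attained, the limit defining $Q(\Lambda_1)$ exists, and $Q_1(\Lambda_1)=Q(\Lambda_1)=0$. 4. The supremum defining $Q_1(\Lambda_0)$ is attained and $Q_1(\Lambda_0)=\log 3$. 5. The suprema $Q_1(\Lambda_x^{\otimes n})$ are finite, the limit defining $Q(\Lambda_x)$ exists, and $$Q(\Lambda_x)\le(1-x)Q_1(\Lambda_0)+xQ_1(\Lambda_1)=(1-x)Q_1(\Lambda_0)=(1-x)\log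 3 .$$ -/

import Mathlib

open Filter Topology
open scoped ComplexOrder

namespace QChan

noncomputable section

/-- A density matrix: positive semidefinite with unit trace. -/
def IsDensity {a : Type*} [Fintype a] (ρ : Matrix a a ℂ) : Prop :=
  ρ.PosSemidef ∧ ρ.trace = 1

/-- Von Neumann entropy in bits, `S(ρ) = -∑ λᵢ log₂ λᵢ` over the eigenvalues of a Hermitian matrix
(with `0 log 0 = 0`). The value on non-Hermitian matrices is irrelevant. -/
def entropy {a : Type*} [Fintype a] [DecidableEq a] (ρ : Matrix a a ℂ) : ℝ :=
  open Classical in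
  if h : ρ.IsHermitian then ∑ i, Real.negMulLog (h.eigenvalues i) / Real.log 2 else 0

/-- A quantum channel: a linear map with a Kraus representation `Φ(X) = ∑ᵢ Kᵢ X Kᵢ†`,
where `∑ᵢ Kᵢ† Kᵢ = 1`. -/
def IsChannel {a b : Type*} [Fintype a] [Fintype b] [DecidableEq a]
    (Φ : Matrix a a ℂ →ₗ[ℂ] Matrix b b ℂ) : Prop :=
  ∃ (m : ℕ) (K : Fin m → Matrix b a ℂ),
    ∑ i, (K i).conjTranspose * K i = 1 ∧
    ∀ X, Φ X = ∑ i, K i * X * (K i).conjTranspose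

/-- Partial trace over the second factor. -/
def traceSnd {b e : Type*} [Fintype e] (M : Matrix (b × e) (b × e) ℂ) : Matrix b b ℂ :=
  Matrix.of fun i j => ∑ k, M (i, k) (j, k)

/-- Partial trace over the first factor. -/
def traceFst {b e : Type*} [Fintype b] (M : Matrix (b × e) (b × e) ℂ) : Matrix e e ℂ :=
  Matrix.of fun k l => ∑ i, M (i, k) (i, l)

/-- `Ψ : A → E` is a complementary channel of `Φ : A → B`: there is a Stinespring isometry
`V : A → B ⊗ E` with `Φ(X) = tr_E (V X V†)` and `Ψ(X) = tr_B (V X V†)`. -/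
def IsComplementary {a b e : Type*} [Fintype a] [Fintype b] [Fintype e] [DecidableEq a]
    (Φ : Matrix a a ℂ →ₗ[ℂ] Matrix b b ℂ) (Ψ : Matrix a a ℂ →ₗ[ℂ] Matrix e e ℂ) : Prop :=
  ∃ V : Matrix (b × e) a ℂ, V.conjTranspose * V = 1 ∧
    (∀ X, Φ X = traceSnd (V * X * V.conjTranspose)) ∧
    (∀ X, Ψ X = traceFst (V * X * V.conjTranspose))

/-- `Φ` is degradable: `N ∘ Φ = Φᶜ` for some channel `N` and some complementary channel `Φᶜ`. -/
def IsDegradable {a b : Type*} [Fintype a] [Fintype b] [DecidableEq a] [DecidableEq b]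
    (Φ : Matrix a a ℂ →ₗ[ℂ] Matrix b b ℂ) : Prop :=
  ∃ (m : ℕ) (Ψ : Matrix a a ℂ →ₗ[ℂ] Matrix (Fin m) (Fin m) ℂ)
    (N : Matrix b b ℂ →ₗ[ℂ] Matrix (Fin m) (Fin m) ℂ),
    IsComplementary Φ Ψ ∧ IsChannel N ∧ N ∘ₗ Φ = Ψ

/-- `Φ` is anti-degradable: `M ∘ Φᶜ = Φ` for some channel `M` and some complementary
channel `Φᶜ`. -/
def IsAntidegradable {a b : Type*} [Fintype a] [Fintype b] [DecidableEq a]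
    (Φ : Matrix a a ℂ →ₗ[ℂ] Matrix b b ℂ) : Prop :=
  ∃ (m : ℕ) (Ψ : Matrix a a ℂ →ₗ[ℂ] Matrix (Fin m) (Fin m) ℂ)
    (M : Matrix (Fin m) (Fin m) ℂ →ₗ[ℂ] Matrix b b ℂ),
    IsComplementary Φ Ψ ∧ IsChannel M ∧ M ∘ₗ Ψ = Φ

/-- All values of the coherent information `I_c(Φ, ρ) = S(Φ(ρ)) - S(Φᶜ(ρ))`, where `ρ` ranges over
the input states (and `Φᶜ` over the complementary channels of `Φ`, whose output entropies
all agree). -/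
def coherentInfoValues {a b : Type*} [Fintype a] [Fintype b] [DecidableEq a] [DecidableEq b]
    (Φ : Matrix a a ℂ →ₗ[ℂ] Matrix b b ℂ) : Set ℝ :=
  {r | ∃ (m : ℕ) (Ψ : Matrix a a ℂ →ₗ[ℂ] Matrix (Fin m) (Fin m) ℂ) (ρ : Matrix a a ℂ),
    IsComplementary Φ Ψ ∧ IsDensity ρ ∧ r = entropy (Φ ρ) - entropy (Ψ ρ)}

/-- The single-letter quantity `Q₁(Φ) = max_ρ I_c(Φ, ρ)`. -/
def Q₁ {a b : Type*} [Fintype a] [Fintype b] [DecidableEq a] [DecidableEq b]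
    (Φ : Matrix a a ℂ →ₗ[ℂ] Matrix b b ℂ) : ℝ :=
  sSup (coherentInfoValues Φ)

/-- The tensor power `Φ^{⊗ n}`; the index set of `A^{⊗ n}` is `Fin n → a`. It is the linear map that
sends the matrix unit `⊗ₜ E_{k t, l t}` to `⊗ₜ Φ(E_{k t, l t})`. -/
def tensorPow {a b : Type*} [Fintype a] [DecidableEq a]
    (Φ : Matrix a a ℂ →ₗ[ℂ] Matrix b b ℂ) (n : ℕ) :
    Matrix (Fin n → a) (Fin n → a) ℂ →ₗ[ℂ] Matrix (Fin n → b) (Fin n → b) ℂ where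
  toFun X := Matrix.of fun i j =>
    ∑ k, ∑ l, X k l * ∏ t, Φ (Matrix.single (k t) (l t) 1) (i t) (j t)
  map_add' X Y := by
    ext i j
    simp [add_mul, Finset.sum_add_distrib]
  map_smul' c X := by
    ext i j
    simp [Finset.mul_sum, mul_assoc]

/-- `Φ^{⊗ n}` acts on product operators factor by factor. -/
theorem tensorPow_product {a b : Type*} [Fintype a] [DecidableEq a]
    (Φ : Matrix a a ℂ →ₗ[ℂ] Matrix b b ℂ) (n : ℕ) (X : Fin n → Matrix a a ℂ) :
    tensorPow Φ n (Matrix.of fun k l => ∏ t, X t (k t) (l t)) =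
      Matrix.of fun i j => ∏ t, Φ (X t) (i t) (j t) := by
  ext i j
  have h : ∀ t, Φ (X t) (i t) (j t) =
      ∑ k, ∑ l, X t k l * Φ (Matrix.single k l 1) (i t) (j t) := by
    intro t
    conv_lhs => rw [Matrix.matrix_eq_sum_single (X t)]
    simp only [map_sum, Matrix.sum_apply]
    refine Finset.sum_congr rfl fun k _ => Finset.sum_congr rfl fun l _ => ?_
    have : Matrix.single k l (X t k l) = X t k l • Matrix.single k l (1 : ℂ) := by
      simp
    rw [this, map_smul]
    simp
  simp only [tensorPow, LinearMap.coe_mk, AddHom.coe_mk, Matrix.of_apply, h,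
    Finset.prod_univ_sum, Fintype.piFinset_univ, Finset.prod_mul_distrib]

/-- The regularised quantum capacity exists and equals `q`: every `Q₁(Φ^{⊗ n})` is a genuine
supremum (of a non-empty set that is bounded above) and `Q₁(Φ^{⊗ n}) / n → q`. -/
def HasQuantumCapacity {a b : Type*} [Fintype a] [Fintype b] [DecidableEq a] [DecidableEq b]
    (Φ : Matrix a a ℂ →ₗ[ℂ] Matrix b b ℂ) (q : ℝ) : Prop :=
  (∀ n, IsLUB (coherentInfoValues (tensorPow Φ n)) (Q₁ (tensorPow Φ n))) ∧
    Tendsto (fun n : ℕ => Q₁ (tensorPow Φ n) / n) atTop (𝓝 q)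

/-- The regularised quantum capacity `Q(Φ) = lim_n Q₁(Φ^{⊗ n}) / n`. -/
def quantumCapacity {a b : Type*} [Fintype a] [Fintype b] [DecidableEq a] [DecidableEq b]
    (Φ : Matrix a a ℂ →ₗ[ℂ] Matrix b b ℂ) : ℝ :=
  limUnder atTop (fun n : ℕ => Q₁ (tensorPow Φ n) / n)

/-- The spin-1 angular momentum matrices `J_x, J_y, J_z`. -/
def spinOne : Fin 3 → Matrix (Fin 3) (Fin 3) ℂ :=
  ![(-Complex.I) • !![0, 0, 0; 0, 0, 1; 0, -1, 0],
    (-Complex.I) • !![0, 0, -1; 0, 0, 0; 1, 0, 0],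
    (-Complex.I) • !![0, 1, 0; -1, 0, 0; 0, 0, 0]]

/-- The qutrit Landau–Streater channel `Λ₁(ρ) = ½ (J_x ρ J_x + J_y ρ J_y + J_z ρ J_z)`. -/
def landauStreater : Matrix (Fin 3) (Fin 3) ℂ →ₗ[ℂ] Matrix (Fin 3) (Fin 3) ℂ where
  toFun X := (1 / 2 : ℂ) • ∑ k, spinOne k * X * spinOne k
  map_add' X Y := by
    simp [mul_add, add_mul, Finset.sum_add_distrib]
  map_smul' c X := by
    simp only [mul_smul_comm, smul_mul_assoc, ← Finset.smul_sum, RingHom.id_apply]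
    exact smul_comm _ _ _

/-- The noisy Landau–Streater channel `Λₓ = (1 - x) id + x Λ₁`. -/
def noisyLandauStreater (x : ℝ) :
    Matrix (Fin 3) (Fin 3) ℂ →ₗ[ℂ] Matrix (Fin 3) (Fin 3) ℂ :=
  (1 - (x : ℂ)) • LinearMap.id + (x : ℂ) • landauStreater

/-- The noiseless qutrit channel `Λ₀ = id`. -/
def idChannel : Matrix (Fin 3) (Fin 3) ℂ →ₗ[ℂ] Matrix (Fin 3) (Fin 3) ℂ :=
  LinearMap.id

end

end QChan

/-! Everything about `landauStreater` comes from one symmetry: the entries of the spin matrices are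
`-i ε_{ijk}`, so exchanging the Kraus index with the output index only changes the sign of the
Stinespring isometry. Hence the channel is its own complement (`isComplementary_landauStreater`),
its tensor powers are too, and their coherent information vanishes identically. For the identity the
environment is trivial, and the maximally mixed state attains `log 3`.

The upper bound for the mixture rests on two facts. With a reference system R purifying the input,
the coherent information is `S(B) - S(BR)`, which is the relative entropy of `ω_BR` to `ω_B ⊗ 1`;
joint convexity of relative entropy therefore makes it convex in the channel
(`coherentInfo_choi_convex`). Moreover the tensor power expands as a binomial mixture over subsets S
of channels that are the identity on S and `Λ` elsewhere (`tensorPow_mixture`). By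
self-complementarity the environment of such a channel has the same entropy as its own output
outside S, so the coherent information is `S(B) - S(B_{Sᶜ})`, at most `|S| log 3`
(`coherentInfo_partialFam_le`). The mean of `|S|` is `n(1-x)`, and dividing by `n` gives the bound.

Joint convexity (`klSum_jointly_convex`) is obtained by writing `a (log a - log b) - a + b` as the
integral over `t > 0` of `(b-a)²/((b+ta)(1+t)²)`. For matrices the numerator and first denominator
become a quadratic form that is a supremum of functions linear in the pair of matrices.

The regularised limit exists by Fekete's lemma: product inputs make `Q₁` superadditive, and `log
|B|` per factor bounds it. -/

set_option linter.unusedSectionVars false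

namespace QChan

open Matrix Real Polynomial Kronecker

/-! ### Spectral decompositions and entropy -/

/-- `ρ = U diag(a) U†` with `U` unitary and `a` real. -/
structure IsDiagonalization {n : Type*} [Fintype n] [DecidableEq n]
    (ρ U : Matrix n n ℂ) (a : n → ℝ) : Prop where
  conjTranspose_mul : Uᴴ * U = 1
  mul_conjTranspose : U * Uᴴ = 1
  eq : ρ = U * diagonal (fun i => (a i : ℂ)) * Uᴴ

section Entropy

variable {m n : Type*} [Fintype m] [Fintype n] [DecidableEq m] [DecidableEq n]

theorem isDiagonalization_eigenvectorUnitary {ρ : Matrix n n ℂ} (h : ρ.IsHermitian) :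
    IsDiagonalization ρ (h.eigenvectorUnitary : Matrix n n ℂ) h.eigenvalues where
  conjTranspose_mul := by
    simpa [star_eq_conjTranspose] using Unitary.coe_star_mul_self h.eigenvectorUnitary
  mul_conjTranspose := by
    simpa [star_eq_conjTranspose] using Unitary.coe_mul_star_self h.eigenvectorUnitary
  eq := by
    conv_lhs => rw [h.spectral_theorem, Unitary.conjStarAlgAut_apply]
    rfl

theorem entropy_eq_sum_roots {ρ : Matrix n n ℂ} (h : ρ.IsHermitian) :
    entropy ρ = (ρ.charpoly.roots.map fun z : ℂ => negMulLog z.re / log 2).sum := by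
  rw [h.roots_charpoly_eq_eigenvalues, Multiset.map_map, entropy, dif_pos h]
  rfl

/-- Zero eigenvalues contribute nothing, so factors of `X` are harmless. The two index types may
differ in size, which is what comparing `A * Aᴴ` with `Aᴴ * A` for rectangular `A` needs. -/
theorem entropy_eq_of_charpoly {ρ : Matrix m m ℂ} {σ : Matrix n n ℂ} (hρ : ρ.IsHermitian)
    (hσ : σ.IsHermitian) {k l : ℕ} (h : X ^ k * ρ.charpoly = X ^ l * σ.charpoly) :
    entropy ρ = entropy σ := by
  have h1 : (X ^ k * ρ.charpoly : ℂ[X]) ≠ 0 :=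
    mul_ne_zero (pow_ne_zero _ X_ne_zero) (charpoly_monic ρ).ne_zero
  have h2 : (X ^ l * σ.charpoly : ℂ[X]) ≠ 0 :=
    mul_ne_zero (pow_ne_zero _ X_ne_zero) (charpoly_monic σ).ne_zero
  have h3 := congrArg
    (fun p : ℂ[X] => (p.roots.map fun z : ℂ => negMulLog z.re / log 2).sum) h
  simp only [roots_mul h1, roots_mul h2, roots_X_pow, Multiset.map_add, Multiset.sum_add,
    Multiset.map_nsmul, Multiset.sum_nsmul] at h3
  simpa [entropy_eq_sum_roots hρ, entropy_eq_sum_roots hσ] using h3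

theorem entropy_mul_conjTranspose (A : Matrix m n ℂ) : entropy (A * Aᴴ) = entropy (Aᴴ * A) :=
  entropy_eq_of_charpoly (isHermitian_mul_conjTranspose_self A)
    (isHermitian_conjTranspose_mul_self A) (charpoly_mul_comm' A Aᴴ)

theorem entropy_transpose {ρ : Matrix n n ℂ} (h : ρ.IsHermitian) : entropy ρᵀ = entropy ρ :=
  entropy_eq_of_charpoly (k := 0) (l := 0) h.transpose h (by rw [charpoly_transpose])

theorem entropy_submatrix (e : m ≃ n) {ρ : Matrix n n ℂ} (h : ρ.IsHermitian) :
    entropy (ρ.submatrix e e) = entropy ρ :=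
  entropy_eq_of_charpoly (k := 0) (l := 0) (h.submatrix e) h
    (by rw [← charpoly_reindex e.symm ρ]; rfl)

namespace IsDiagonalization

variable {ρ U : Matrix n n ℂ} {a : n → ℝ}

theorem isHermitian (h : IsDiagonalization ρ U a) : ρ.IsHermitian := by
  rw [h.eq]
  refine isHermitian_mul_mul_conjTranspose U ?_
  rw [IsHermitian, diagonal_conjTranspose]
  congr 1
  ext i
  simp

/-- The characteristic polynomial forgets the choice of eigenbasis; this frees later arguments from
Mathlib's ordered eigenvalues, in particular for tensor products of eigenbases. -/
theorem entropy_eq (h : IsDiagonalization ρ U a) :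
    entropy ρ = (∑ i, negMulLog (a i)) / log 2 := by
  have hc : ρ.charpoly = ∏ i, (X - C (a i : ℂ)) := by
    rw [h.eq, charpoly_mul_comm, ← mul_assoc, h.conjTranspose_mul, one_mul, charpoly_diagonal]
  rw [entropy_eq_sum_roots h.isHermitian, hc, roots_prod _ _
    (Finset.prod_ne_zero_iff.2 fun i _ => X_sub_C_ne_zero _), Finset.sum_div]
  simp

theorem conj_eq (h : IsDiagonalization ρ U a) :
    Uᴴ * ρ * U = diagonal (fun i => (a i : ℂ)) := by
  rw [h.eq]
  calc _ = (Uᴴ * U) * diagonal (fun i => (a i : ℂ)) * (Uᴴ * U) := by simp only [mul_assoc]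
    _ = _ := by rw [h.conjTranspose_mul, one_mul, mul_one]

theorem nonneg (h : IsDiagonalization ρ U a) (hρ : ρ.PosSemidef) (i : n) : 0 ≤ a i := by
  have h1 := (hρ.conjTranspose_mul_mul_same U).diag_nonneg (i := i)
  rw [h.conj_eq, diagonal_apply_eq] at h1
  exact_mod_cast h1

theorem trace_eq (h : IsDiagonalization ρ U a) : ρ.trace = ((∑ i, a i : ℝ) : ℂ) := by
  rw [h.eq, trace_mul_comm, ← mul_assoc, h.conjTranspose_mul, one_mul, trace_diagonal]
  simp

theorem sum_eq_one (h : IsDiagonalization ρ U a) (hρ : IsDensity ρ) : ∑ i, a i = 1 := by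
  have := h.trace_eq.symm.trans hρ.2
  exact_mod_cast this

theorem kronecker {σ V : Matrix m m ℂ} {b : m → ℝ} (h : IsDiagonalization ρ U a)
    (h' : IsDiagonalization σ V b) :
    IsDiagonalization (ρ ⊗ₖ σ) (U ⊗ₖ V) (fun i => a i.1 * b i.2) where
  conjTranspose_mul := by
    rw [conjTranspose_kronecker, ← mul_kronecker_mul, h.conjTranspose_mul, h'.conjTranspose_mul,
      one_kronecker_one]
  mul_conjTranspose := by
    rw [conjTranspose_kronecker, ← mul_kronecker_mul, h.mul_conjTranspose, h'.mul_conjTranspose,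
      one_kronecker_one]
  eq := by
    have : diagonal (fun i : n × m => ((a i.1 * b i.2 : ℝ) : ℂ)) =
        diagonal (fun i => (a i : ℂ)) ⊗ₖ diagonal (fun i => (b i : ℂ)) := by
      rw [diagonal_kronecker_diagonal]
      simp
    rw [this, conjTranspose_kronecker, ← mul_kronecker_mul, ← mul_kronecker_mul, ← h.eq, ← h'.eq]

end IsDiagonalization

theorem isDiagonalization_one : IsDiagonalization (1 : Matrix n n ℂ) 1 (fun _ => 1) where
  conjTranspose_mul := by simp
  mul_conjTranspose := by simp
  eq := by simp

theorem entropy_kronecker {ρ : Matrix n n ℂ} {σ : Matrix m m ℂ} (hρ : IsDensity ρ)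
    (hσ : IsDensity σ) : entropy (ρ ⊗ₖ σ) = entropy ρ + entropy σ := by
  have h1 := isDiagonalization_eigenvectorUnitary hρ.1.1
  have h2 := isDiagonalization_eigenvectorUnitary hσ.1.1
  rw [(h1.kronecker h2).entropy_eq, h1.entropy_eq, h2.entropy_eq, ← add_div]
  congr 1
  simp only [negMulLog_mul, Finset.sum_add_distrib, Fintype.sum_prod_type]
  rw [Finset.sum_comm]
  simp only [← Finset.sum_mul, ← Finset.mul_sum, h1.sum_eq_one hρ, h2.sum_eq_one hσ, one_mul]

theorem IsDensity.kronecker {ρ : Matrix n n ℂ} {σ : Matrix m m ℂ} (hρ : IsDensity ρ)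
    (hσ : IsDensity σ) : IsDensity (ρ ⊗ₖ σ) :=
  ⟨hρ.1.kronecker hσ.1, by rw [trace_kronecker, hρ.2, hσ.2, one_mul]⟩

theorem IsDensity.submatrix {ρ : Matrix n n ℂ} (hρ : IsDensity ρ) (e : m ≃ n) :
    IsDensity (ρ.submatrix e e) :=
  ⟨hρ.1.submatrix e, by
    rw [← hρ.2]
    exact Equiv.sum_comp e fun i => ρ i i⟩

theorem entropy_nonneg {ρ : Matrix n n ℂ} (hρ : IsDensity ρ) : 0 ≤ entropy ρ := by
  have h := isDiagonalization_eigenvectorUnitary hρ.1.1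
  rw [h.entropy_eq]
  refine div_nonneg (Finset.sum_nonneg fun i _ => negMulLog_nonneg (h.nonneg hρ.1 i) ?_)
    (log_nonneg one_le_two)
  rw [← h.sum_eq_one hρ]
  exact Finset.single_le_sum (fun j _ => h.nonneg hρ.1 j) (Finset.mem_univ i)

theorem entropy_eq_zero_of_unique [Unique n] {ρ : Matrix n n ℂ} (hρ : IsDensity ρ) :
    entropy ρ = 0 := by
  have h := isDiagonalization_eigenvectorUnitary hρ.1.1
  have h1 := h.sum_eq_one hρ
  rw [h.entropy_eq]
  simp only [Fintype.sum_unique] at h1 ⊢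
  simp [h1]

/-- A rank-one density matrix has zero entropy. -/
theorem entropy_mul_conjTranspose_of_unique [Unique m] (A : Matrix n m ℂ)
    (h : IsDensity (A * Aᴴ)) : entropy (A * Aᴴ) = 0 := by
  rw [entropy_mul_conjTranspose]
  exact entropy_eq_zero_of_unique
    ⟨posSemidef_conjTranspose_mul_self A, by rw [trace_mul_comm]; exact h.2⟩

end Entropy

end QChan

namespace QChan

open Matrix Real MeasureTheory

/-! ### Joint convexity of the relative entropy

For diagonalised `ρ = U diag(a) U†`, `σ = W diag(b) W†` and `G = U† W`, the relative entropy is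
`klSum G a b`. It is an integral over `t` of the quadratic forms `klQuad t G a b`, each of which is
a supremum of functions that are affine in `(ρ, σ)`. -/

/-! ### Scalar integral representation and Klein's inequality -/

section Scalar

theorem integral_kl_kernel_aux {a b : ℝ} (ha : 0 ≤ a) (hb : 0 < b) :
    IntegrableOn (fun t => (b - a) ^ 2 / (b + t * a) / (1 + t) ^ 2) (Set.Ioi 0) ∧
      ∫ t in Set.Ioi (0 : ℝ), (b - a) ^ 2 / (b + t * a) / (1 + t) ^ 2 =
        a * (log a - log b) - a + b := by
  -- An explicit primitive: it equals `a log b - (b - a)` at `0` and tends to `a log a` at infinity.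
  set H : ℝ → ℝ := fun t => a * log ((b + t * a) / (1 + t)) - (b - a) / (1 + t) with hH
  have hder : ∀ t ∈ Set.Ici (0 : ℝ),
      HasDerivAt H ((b - a) ^ 2 / (b + t * a) / (1 + t) ^ 2) t := by
    intro t ht
    have ht : 0 ≤ t := ht
    have h1 : 0 < b + t * a := by positivity
    have h2 : 0 < 1 + t := by positivity
    have hn : HasDerivAt (fun t : ℝ => b + t * a) a t := by
      simpa using ((hasDerivAt_id t).mul_const a).const_add b
    have hd : HasDerivAt (fun t : ℝ => 1 + t) 1 t := (hasDerivAt_id t).const_add 1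
    have h3 := (((hn.div hd h2.ne').log (div_pos h1 h2).ne').const_mul a).sub
      ((hasDerivAt_const t (b - a)).div hd h2.ne')
    refine h3.congr_deriv ?_
    simp only [Pi.div_apply]
    field_simp
    ring
  have hnn : ∀ t ∈ Set.Ioi (0 : ℝ), 0 ≤ (b - a) ^ 2 / (b + t * a) / (1 + t) ^ 2 := by
    intro t ht
    have ht : 0 < t := ht
    positivity
  have hlim1 : Tendsto (fun t : ℝ => (1 + t)⁻¹) atTop (𝓝 0) :=
    (tendsto_atTop_add_const_left _ 1 tendsto_id).inv_tendsto_atTop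
  have hlim2 : Tendsto (fun t : ℝ => (b + t * a) / (1 + t)) atTop (𝓝 a) := by
    have h : Tendsto (fun t : ℝ => a + (b - a) * (1 + t)⁻¹) atTop (𝓝 (a + (b - a) * 0)) :=
      (hlim1.const_mul _).const_add _
    rw [mul_zero, add_zero] at h
    refine h.congr' ?_
    filter_upwards [eventually_ge_atTop 0] with t ht
    have h2 : (1 + t) ≠ 0 := by positivity
    field_simp
    ring
  have hlim : Tendsto H atTop (𝓝 (a * log a)) := by
    have h0 : Tendsto (fun t : ℝ => (b - a) / (1 + t)) atTop (𝓝 0) := by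
      simpa [div_eq_mul_inv] using hlim1.const_mul (b - a)
    rcases ha.eq_or_lt with rfl | ha
    · simpa [hH] using h0.neg
    · simpa using ((hlim2.log ha.ne').const_mul a).sub h0
  refine ⟨integrableOn_Ioi_deriv_of_nonneg' hder hnn hlim, ?_⟩
  rw [integral_Ioi_of_hasDerivAt_of_nonneg' hder hnn hlim]
  simp [hH]
  ring

theorem integral_kl_kernel {w a b : ℝ} (ha : 0 ≤ a) (hb : 0 ≤ b) (h : b = 0 → w * a = 0) :
    IntegrableOn (fun t => w * (b - a) ^ 2 / (b + t * a) / (1 + t) ^ 2) (Set.Ioi 0) ∧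
      ∫ t in Set.Ioi (0 : ℝ), w * (b - a) ^ 2 / (b + t * a) / (1 + t) ^ 2 =
        w * (a * (log a - log b)) - w * a + w * b := by
  rcases hb.eq_or_lt with rfl | hb
  · rcases mul_eq_zero.1 (h rfl) with rfl | rfl <;> simp
  · obtain ⟨h1, h2⟩ := integral_kl_kernel_aux ha hb
    have he : (fun t => w * (b - a) ^ 2 / (b + t * a) / (1 + t) ^ 2) =
        fun t => w * ((b - a) ^ 2 / (b + t * a) / (1 + t) ^ 2) := by
      ext t
      ring
    rw [he]
    refine ⟨h1.const_mul w, ?_⟩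
    rw [integral_const_mul, h2]
    ring

/-- This is `log x ≤ x - 1` at `x = b / (d a)`. The parameter `d` will be the dimension by which
`ω_B ⊗ 1` has to be divided to have trace one. -/
theorem mul_log_sub_log_ge {w a b d : ℝ} (hw : 0 ≤ w) (ha : 0 ≤ a) (hb : 0 ≤ b) (hd : 0 < d)
    (h : b = 0 → w * a = 0) :
    w * a - w * b / d - w * a * log d ≤ w * (a * (log a - log b)) := by
  rcases hb.eq_or_lt with rfl | hb
  · have := h rfl
    rw [← mul_assoc, this]
    simp
  rcases ha.eq_or_lt with rfl | ha
  · simp only [mul_zero, zero_mul, zero_sub, sub_zero, neg_nonpos]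
    positivity
  have h1 := log_le_sub_one_of_pos (show 0 < b / (d * a) by positivity)
  rw [log_div hb.ne' (by positivity), log_mul hd.ne' ha.ne'] at h1
  have h2 := mul_le_mul_of_nonneg_left h1 (mul_nonneg hw ha.le)
  have h3 : w * a * (b / (d * a) - 1) = w * b / d - w * a := by
    field_simp
  rw [h3] at h2
  linarith

end Scalar

/-! ### Relative entropy as an integral of suprema of affine functions -/

section KL

variable {n : Type*} [Fintype n]

/-- The relative entropy of two diagonalised matrices with overlap matrix `G`, in nats. -/
noncomputable def klSum (G : Matrix n n ℂ) (a b : n → ℝ) : ℝ :=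
  ∑ i, ∑ j, ‖G i j‖ ^ 2 * (a i * (log (a i) - log (b j)))

/-- The integrand of the integral representation of `klSum`. -/
noncomputable def klQuad (t : ℝ) (G : Matrix n n ℂ) (a b : n → ℝ) : ℝ :=
  ∑ i, ∑ j, ‖G i j‖ ^ 2 * (b j - a i) ^ 2 / (b j + t * a i)

theorem integral_klQuad {G : Matrix n n ℂ} {a b : n → ℝ} (ha : ∀ i, 0 ≤ a i)
    (hb : ∀ j, 0 ≤ b j) (h : ∀ i j, b j = 0 → ‖G i j‖ ^ 2 * a i = 0) :
    IntegrableOn (fun t => klQuad t G a b / (1 + t) ^ 2) (Set.Ioi 0) ∧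
      ∫ t in Set.Ioi (0 : ℝ), klQuad t G a b / (1 + t) ^ 2 =
        klSum G a b - ∑ i, ∑ j, ‖G i j‖ ^ 2 * a i + ∑ i, ∑ j, ‖G i j‖ ^ 2 * b j := by
  have hk := fun i j => integral_kl_kernel (w := ‖G i j‖ ^ 2) (ha i) (hb j) (h i j)
  have he : (fun t => klQuad t G a b / (1 + t) ^ 2) = fun t =>
      ∑ i, ∑ j, ‖G i j‖ ^ 2 * (b j - a i) ^ 2 / (b j + t * a i) / (1 + t) ^ 2 := by
    ext t
    simp only [klQuad, Finset.sum_div]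
  rw [he]
  refine ⟨integrable_finsetSum _ fun i _ => integrable_finsetSum _ fun j _ => (hk i j).1, ?_⟩
  rw [integral_finsetSum _ fun i _ => integrable_finsetSum _ fun j _ => (hk i j).1, klSum,
    ← Finset.sum_sub_distrib, ← Finset.sum_add_distrib]
  refine Finset.sum_congr rfl fun i _ => ?_
  rw [integral_finsetSum _ fun j _ => (hk i j).1, ← Finset.sum_sub_distrib,
    ← Finset.sum_add_distrib]
  exact Finset.sum_congr rfl fun j _ => (hk i j).2

variable [DecidableEq n]

/-- The affine minorants of `klQuad t`. -/
noncomputable def klAffine (t : ℝ) (ρ σ Y : Matrix n n ℂ) : ℝ :=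
  (2 * (Yᴴ * (σ - ρ)).trace - (Yᴴ * (Y * σ + (t : ℂ) • (ρ * Y))).trace).re

/-- In the coordinates `Z = Uᴴ Y W`, left multiplication by `ρ` and right multiplication by `σ` are
both diagonal, so the problem decouples into one scalar quadratic per entry. -/
theorem klAffine_eq {ρ σ U W : Matrix n n ℂ} {a b : n → ℝ} (hρ : IsDiagonalization ρ U a)
    (hσ : IsDiagonalization σ W b) (t : ℝ) (Z : Matrix n n ℂ) :
    klAffine t ρ σ (U * Z * Wᴴ) = ∑ i, ∑ j,
      (2 * (star (Z i j) * (Uᴴ * W) i j).re * (b j - a i) - ‖Z i j‖ ^ 2 * (b j + t * a i)) := by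
  have e1 : ((U * Z * Wᴴ)ᴴ * (σ - ρ)).trace =
      ∑ i, ∑ j, star (Z i j) * (Uᴴ * W) i j * (b j - a i) := by
    have : ((U * Z * Wᴴ)ᴴ * (σ - ρ)).trace = (Zᴴ * ((Uᴴ * W) * diagonal (fun i => (b i : ℂ)) -
        diagonal (fun i => (a i : ℂ)) * (Uᴴ * W))).trace := by
      have h1 : (U * Z * Wᴴ)ᴴ * (σ - ρ) = W * (Zᴴ * Uᴴ * (σ - ρ)) := by
        simp only [conjTranspose_mul, conjTranspose_conjTranspose, Matrix.mul_assoc]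
      rw [h1, trace_mul_comm, hσ.eq, hρ.eq]
      congr 1
      simp only [Matrix.mul_sub, Matrix.sub_mul, Matrix.mul_assoc, hσ.conjTranspose_mul,
        Matrix.mul_one]
      simp only [← Matrix.mul_assoc Uᴴ U, hρ.conjTranspose_mul, Matrix.one_mul]
    rw [this, trace, Finset.sum_comm]
    refine Finset.sum_congr rfl fun j _ => ?_
    rw [diag_apply, mul_apply]
    refine Finset.sum_congr rfl fun i _ => ?_
    rw [Matrix.sub_apply, mul_diagonal, diagonal_mul, conjTranspose_apply]
    ring
  have e2 : ((U * Z * Wᴴ)ᴴ * ((U * Z * Wᴴ) * σ + (t : ℂ) • (ρ * (U * Z * Wᴴ)))).trace =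
      ∑ i, ∑ j, star (Z i j) * Z i j * (b j + t * a i) := by
    have : ((U * Z * Wᴴ)ᴴ * ((U * Z * Wᴴ) * σ + (t : ℂ) • (ρ * (U * Z * Wᴴ)))).trace =
        (Zᴴ * (Z * diagonal (fun i => (b i : ℂ)) +
          (t : ℂ) • (diagonal (fun i => (a i : ℂ)) * Z))).trace := by
      have h1 : (U * Z * Wᴴ)ᴴ * ((U * Z * Wᴴ) * σ + (t : ℂ) • (ρ * (U * Z * Wᴴ))) =
          W * (Zᴴ * Uᴴ * ((U * Z * Wᴴ) * σ + (t : ℂ) • (ρ * (U * Z * Wᴴ)))) := by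
        simp only [conjTranspose_mul, conjTranspose_conjTranspose, Matrix.mul_assoc]
      rw [h1, trace_mul_comm, hσ.eq, hρ.eq]
      congr 1
      simp only [Matrix.mul_add, Matrix.add_mul, Matrix.mul_assoc, hσ.conjTranspose_mul,
        Matrix.mul_one, Matrix.mul_smul, Matrix.smul_mul]
      simp only [← Matrix.mul_assoc Uᴴ U, ← Matrix.mul_assoc Wᴴ W, hρ.conjTranspose_mul,
        hσ.conjTranspose_mul, Matrix.one_mul]
    rw [this, trace, Finset.sum_comm]
    refine Finset.sum_congr rfl fun j _ => ?_
    rw [diag_apply, mul_apply]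
    refine Finset.sum_congr rfl fun i _ => ?_
    rw [Matrix.add_apply, Matrix.smul_apply, mul_diagonal, diagonal_mul, conjTranspose_apply,
      smul_eq_mul]
    ring
  rw [klAffine, e1, e2, Finset.mul_sum, ← Finset.sum_sub_distrib, Complex.re_sum]
  refine Finset.sum_congr rfl fun i _ => ?_
  rw [Finset.mul_sum, ← Finset.sum_sub_distrib, Complex.re_sum]
  refine Finset.sum_congr rfl fun j _ => ?_
  have h1 : star (Z i j) * Z i j * ((b j : ℂ) + t * a i) =
      ((‖Z i j‖ ^ 2 * (b j + t * a i) : ℝ) : ℂ) := by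
    rw [Complex.star_def, Complex.conj_mul']
    push_cast
    ring
  have h2 : 2 * (star (Z i j) * (Uᴴ * W) i j * ((b j : ℂ) - a i)) =
      star (Z i j) * (Uᴴ * W) i j * ((2 * (b j - a i) : ℝ) : ℂ) := by
    push_cast
    ring
  rw [Complex.sub_re, h1, h2, Complex.ofReal_re, Complex.re_mul_ofReal]
  ring

theorem klAffine_le_klQuad {ρ σ U W : Matrix n n ℂ} {a b : n → ℝ}
    (hρ : IsDiagonalization ρ U a) (hσ : IsDiagonalization σ W b) (ha : ∀ i, 0 ≤ a i)
    (hb : ∀ j, 0 ≤ b j) {t : ℝ} (ht : 0 < t) (Y : Matrix n n ℂ) :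
    klAffine t ρ σ Y ≤ klQuad t (Uᴴ * W) a b := by
  have hY : Y = U * (Uᴴ * Y * W) * Wᴴ := by
    calc Y = (U * Uᴴ) * Y * (W * Wᴴ) := by
          rw [hρ.mul_conjTranspose, hσ.mul_conjTranspose, Matrix.one_mul, Matrix.mul_one]
      _ = _ := by simp only [Matrix.mul_assoc]
  rw [hY, klAffine_eq hρ hσ]
  refine Finset.sum_le_sum fun i _ => Finset.sum_le_sum fun j _ => ?_
  generalize (Uᴴ * Y * W) i j = z
  generalize (Uᴴ * W) i j = g
  have h1 : |(star z * g).re| ≤ ‖z‖ * ‖g‖ := by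
    simpa using Complex.abs_re_le_norm (star z * g)
  have h2 : (star z * g).re * (b j - a i) ≤ ‖z‖ * ‖g‖ * |b j - a i| := by
    refine (le_abs_self _).trans ?_
    rw [abs_mul]
    exact mul_le_mul_of_nonneg_right h1 (abs_nonneg _)
  have hta := mul_nonneg ht.le (ha i)
  -- If the denominator vanishes then, as `t > 0`, both eigenvalues are zero and the quotient `0 / 0
  -- = 0` is the right value. Otherwise the bound is a completed square.
  rcases (add_nonneg (hb j) hta).eq_or_lt with hc | hc
  · have hb0 : b j = 0 := by linarith [hb j]
    have ha0 : a i = 0 := by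
      have : t * a i = 0 := by linarith
      simpa [ht.ne'] using this
    simp [hb0, ha0]
  · rw [le_div_iff₀ hc, ← sq_abs (b j - a i)]
    nlinarith [sq_nonneg (‖z‖ * (b j + t * a i) - ‖g‖ * |b j - a i|)]

theorem exists_klAffine_eq_klQuad {ρ σ U W : Matrix n n ℂ} {a b : n → ℝ}
    (hρ : IsDiagonalization ρ U a) (hσ : IsDiagonalization σ W b) (ha : ∀ i, 0 ≤ a i)
    (hb : ∀ j, 0 ≤ b j) {t : ℝ} (ht : 0 < t) :
    ∃ Y, klAffine t ρ σ Y = klQuad t (Uᴴ * W) a b := by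
  -- The entrywise maximiser of `2 Re(z̄ g)(b - a) - |z|² (b + t a)`.
  refine ⟨U * (Matrix.of fun i j =>
    (Uᴴ * W) i j * (((b j - a i) / (b j + t * a i) : ℝ) : ℂ)) * Wᴴ, ?_⟩
  rw [klAffine_eq hρ hσ]
  refine Finset.sum_congr rfl fun i _ => Finset.sum_congr rfl fun j _ => ?_
  rw [of_apply]
  generalize (Uᴴ * W) i j = g
  set r := (b j - a i) / (b j + t * a i) with hr
  have h1 : star (g * (r : ℂ)) * g = ((‖g‖ ^ 2 * r : ℝ) : ℂ) := by
    rw [star_mul', mul_right_comm, Complex.star_def, Complex.conj_mul',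
      Complex.conj_ofReal]
    push_cast
    ring
  rw [h1, Complex.ofReal_re, norm_mul, Complex.norm_real, mul_pow, Real.norm_eq_abs, sq_abs]
  have hta := mul_nonneg ht.le (ha i)
  rcases (add_nonneg (hb j) hta).eq_or_lt with hc | hc
  · rw [hr, ← hc]
    simp
  · rw [hr]
    have := hc.ne'
    field_simp
    ring

/-- For fixed `Y` the expression is real-linear in the pair `(ρ, σ)`, with no constant term, so the
weights need not sum to one. -/
theorem klAffine_sum {ι : Type*} (s : Finset ι) (p : ι → ℝ) (ρ σ : ι → Matrix n n ℂ) (t : ℝ)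
    (Y : Matrix n n ℂ) :
    klAffine t (∑ k ∈ s, (p k : ℂ) • ρ k) (∑ k ∈ s, (p k : ℂ) • σ k) Y =
      ∑ k ∈ s, p k * klAffine t (ρ k) (σ k) Y := by
  have h : ∀ k, p k * klAffine t (ρ k) (σ k) Y =
      (2 * (Yᴴ * ((p k : ℂ) • σ k - (p k : ℂ) • ρ k)).trace -
        (Yᴴ * (Y * ((p k : ℂ) • σ k) + (t : ℂ) • (((p k : ℂ) • ρ k) * Y))).trace).re := by
    intro k
    rw [klAffine, ← Complex.re_ofReal_mul, ← smul_sub, Matrix.smul_mul,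
      smul_comm (t : ℂ), Matrix.mul_smul, Matrix.mul_smul, ← smul_add, Matrix.mul_smul,
      trace_smul, trace_smul, smul_eq_mul, smul_eq_mul]
    congr 1
    ring
  simp only [h]
  rw [klAffine, ← Complex.re_sum, Finset.sum_sub_distrib, ← Finset.mul_sum, ← trace_sum, ← trace_sum,
    ← Matrix.mul_sum, ← Matrix.mul_sum, Finset.sum_sub_distrib, Finset.sum_add_distrib,
    ← Matrix.mul_sum, ← Finset.smul_sum, ← Matrix.sum_mul]

theorem sum_norm_sq_row {G : Matrix n n ℂ} (h : G * Gᴴ = 1) (i : n) : ∑ j, ‖G i j‖ ^ 2 = 1 := by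
  have h1 := congrFun (congrFun h i) i
  rw [mul_apply, one_apply_eq] at h1
  simp only [conjTranspose_apply, Complex.star_def, Complex.mul_conj'] at h1
  exact_mod_cast h1

theorem sum_norm_sq_col {G : Matrix n n ℂ} (h : Gᴴ * G = 1) (j : n) : ∑ i, ‖G i j‖ ^ 2 = 1 := by
  have h1 := congrFun (congrFun h j) j
  rw [mul_apply, one_apply_eq] at h1
  simp only [conjTranspose_apply, Complex.star_def, Complex.conj_mul'] at h1
  exact_mod_cast h1

namespace IsDiagonalization

variable {ρ σ U W : Matrix n n ℂ} {a b : n → ℝ}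

theorem overlap_mul (hρ : IsDiagonalization ρ U a) (hσ : IsDiagonalization σ W b) :
    (Uᴴ * W) * (Uᴴ * W)ᴴ = 1 := by
  rw [Matrix.conjTranspose_mul, conjTranspose_conjTranspose, Matrix.mul_assoc, ← Matrix.mul_assoc W,
    hσ.mul_conjTranspose, Matrix.one_mul, hρ.conjTranspose_mul]

theorem mul_overlap (hρ : IsDiagonalization ρ U a) (hσ : IsDiagonalization σ W b) :
    (Uᴴ * W)ᴴ * (Uᴴ * W) = 1 := by
  rw [Matrix.conjTranspose_mul, conjTranspose_conjTranspose, Matrix.mul_assoc, ← Matrix.mul_assoc U,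
    hρ.mul_conjTranspose, Matrix.one_mul, hσ.conjTranspose_mul]

theorem sum_overlap_left (hρ : IsDiagonalization ρ U a) (hσ : IsDiagonalization σ W b)
    (f : n → ℝ) : ∑ i, ∑ j, ‖(Uᴴ * W) i j‖ ^ 2 * f i = ∑ i, f i := by
  simp only [← Finset.sum_mul, sum_norm_sq_row (hρ.overlap_mul hσ), one_mul]

theorem sum_overlap_right (hρ : IsDiagonalization ρ U a) (hσ : IsDiagonalization σ W b)
    (f : n → ℝ) : ∑ i, ∑ j, ‖(Uᴴ * W) i j‖ ^ 2 * f j = ∑ j, f j := by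
  rw [Finset.sum_comm]
  simp only [← Finset.sum_mul, sum_norm_sq_col (hρ.mul_overlap hσ), one_mul]

end IsDiagonalization

/-- Joint convexity of the relative entropy, for states whose traces are compatible. -/
theorem klSum_jointly_convex {ι : Type*} (s : Finset ι) {p : ι → ℝ} (hp : ∀ k ∈ s, 0 ≤ p k)
    {ρ σ U W : ι → Matrix n n ℂ} {a b : ι → n → ℝ}
    (hρ : ∀ k, IsDiagonalization (ρ k) (U k) (a k))
    (hσ : ∀ k, IsDiagonalization (σ k) (W k) (b k)) (ha : ∀ k i, 0 ≤ a k i)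
    (hb : ∀ k j, 0 ≤ b k j)
    (hs : ∀ k i j, b k j = 0 → ‖((U k)ᴴ * W k) i j‖ ^ 2 * a k i = 0)
    {U₀ W₀ : Matrix n n ℂ} {a₀ b₀ : n → ℝ}
    (hρ₀ : IsDiagonalization (∑ k ∈ s, (p k : ℂ) • ρ k) U₀ a₀)
    (hσ₀ : IsDiagonalization (∑ k ∈ s, (p k : ℂ) • σ k) W₀ b₀) (ha₀ : ∀ i, 0 ≤ a₀ i)
    (hb₀ : ∀ j, 0 ≤ b₀ j) (hs₀ : ∀ i j, b₀ j = 0 → ‖(U₀ᴴ * W₀) i j‖ ^ 2 * a₀ i = 0) :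
    klSum (U₀ᴴ * W₀) a₀ b₀ ≤ ∑ k ∈ s, p k * klSum ((U k)ᴴ * W k) (a k) (b k) := by
  obtain ⟨i0, e0⟩ := integral_klQuad ha₀ hb₀ hs₀
  have hk := fun k => integral_klQuad (ha k) (hb k) (hs k)
  have hint : IntegrableOn (fun t => ∑ k ∈ s, p k *
      (klQuad t ((U k)ᴴ * W k) (a k) (b k) / (1 + t) ^ 2)) (Set.Ioi 0) :=
    integrable_finsetSum _ fun k _ => (hk k).1.const_mul (p k)
  have hle := setIntegral_mono_on i0 hint measurableSet_Ioi fun t (ht : 0 < t) => by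
    -- The `Y` optimal for the mixture is a test matrix for every component: a supremum of linear
    -- functions is convex.
    obtain ⟨Y, hY⟩ := exists_klAffine_eq_klQuad hρ₀ hσ₀ ha₀ hb₀ ht
    rw [← hY, klAffine_sum, Finset.sum_div]
    refine Finset.sum_le_sum fun k hks => ?_
    rw [mul_div_assoc]
    refine mul_le_mul_of_nonneg_left ?_ (hp k hks)
    exact div_le_div_of_nonneg_right
      (klAffine_le_klQuad (hρ k) (hσ k) (ha k) (hb k) ht Y) (sq_nonneg _)
  rw [e0, integral_finsetSum _ fun k _ => (hk k).1.const_mul (p k)] at hle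
  simp only [integral_const_mul, (hk _).2] at hle
  rw [hρ₀.sum_overlap_left hσ₀, hρ₀.sum_overlap_right hσ₀] at hle
  simp only [(hρ _).sum_overlap_left (hσ _), (hρ _).sum_overlap_right (hσ _)] at hle
  -- The terms `-tr ρ + tr σ` left over from the scalar integral are linear, so they cancel between
  -- the two sides.
  have t1 : ∑ i, a₀ i = ∑ k ∈ s, p k * ∑ i, a k i := by
    have h := hρ₀.trace_eq
    rw [trace_sum] at h
    simp only [trace_smul, (hρ _).trace_eq, smul_eq_mul] at h
    exact_mod_cast h.symm
  have t2 : ∑ i, b₀ i = ∑ k ∈ s, p k * ∑ i, b k i := by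
    have h := hσ₀.trace_eq
    rw [trace_sum] at h
    simp only [trace_smul, (hσ _).trace_eq, smul_eq_mul] at h
    exact_mod_cast h.symm
  simp only [mul_add, mul_sub, Finset.sum_add_distrib, Finset.sum_sub_distrib] at hle
  linarith

end KL

end QChan

namespace QChan

open Matrix Real Kronecker

/-! ### Conditional entropy -/

section Partial

variable {b r : Type*} [Fintype b] [Fintype r]

theorem traceSnd_eq_sum (M : Matrix (b × r) (b × r) ℂ) :
    traceSnd M = ∑ k, M.submatrix (fun i => (i, k)) (fun i => (i, k)) := by
  ext i j
  simp [traceSnd, Matrix.sum_apply]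

theorem traceFst_eq_traceSnd (M : Matrix (b × r) (b × r) ℂ) :
    traceFst M = traceSnd (M.submatrix Prod.swap Prod.swap) := rfl

theorem IsDensity.traceSnd {ω : Matrix (b × r) (b × r) ℂ} (h : IsDensity ω) :
    IsDensity (traceSnd ω) := by
  refine ⟨?_, ?_⟩
  · rw [traceSnd_eq_sum]
    exact posSemidef_sum _ fun k _ => h.1.submatrix _
  · rw [← h.2]
    simp [QChan.traceSnd, trace, Fintype.sum_prod_type]

theorem IsDensity.traceFst {ω : Matrix (b × r) (b × r) ℂ} (h : IsDensity ω) :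
    IsDensity (traceFst ω) := by
  classical
  rw [traceFst_eq_traceSnd]
  exact (h.submatrix (Equiv.prodComm r b)).traceSnd

theorem traceSnd_sum_smul {ι : Type*} (s : Finset ι) (p : ι → ℂ)
    (M : ι → Matrix (b × r) (b × r) ℂ) :
    traceSnd (∑ k ∈ s, p k • M k) = ∑ k ∈ s, p k • traceSnd (M k) := by
  ext i j
  simp only [traceSnd, Matrix.sum_apply, Matrix.smul_apply, of_apply, smul_eq_mul, Finset.mul_sum]
  exact Finset.sum_comm

variable [DecidableEq b] [DecidableEq r]

theorem traceSnd_conj (A B : Matrix b b ℂ) (M : Matrix (b × r) (b × r) ℂ) :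
    traceSnd ((A ⊗ₖ (1 : Matrix r r ℂ)) * M * (B ⊗ₖ (1 : Matrix r r ℂ))) =
      A * traceSnd M * B := by
  ext i j
  simp only [traceSnd, of_apply, mul_apply, Fintype.sum_prod_type, kroneckerMap_apply, one_apply,
    mul_ite, mul_one, mul_zero, ite_mul, zero_mul, Finset.sum_ite_eq, Finset.sum_ite_eq',
    Finset.mem_univ, if_true, Finset.mul_sum, Finset.sum_mul]
  rw [Finset.sum_comm]
  exact Finset.sum_congr rfl fun _ _ => Finset.sum_comm

variable {ω U : Matrix (b × r) (b × r) ℂ} {W : Matrix b b ℂ} {a : b × r → ℝ} {β : b → ℝ}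

theorem IsDiagonalization.kronecker_one {σ : Matrix b b ℂ} (hB : IsDiagonalization σ W β) :
    IsDiagonalization (σ ⊗ₖ (1 : Matrix r r ℂ)) (W ⊗ₖ (1 : Matrix r r ℂ)) (fun i => β i.1) := by
  simpa using hB.kronecker (isDiagonalization_one (n := r))

/-- Conjugating by `W ⊗ 1` commutes with the partial trace; the identity compares diagonal entries
of the marginal in its eigenbasis. -/
theorem sum_overlap_traceSnd (hω : IsDiagonalization ω U a)
    (hB : IsDiagonalization (traceSnd ω) W β) (j : b) :
    ∑ k, ∑ i, ‖(Uᴴ * (W ⊗ₖ (1 : Matrix r r ℂ))) i (j, k)‖ ^ 2 * a i = β j := by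
  have h1 := traceSnd_conj Wᴴ W ω
  rw [hB.conj_eq] at h1
  have h2 : (Wᴴ ⊗ₖ (1 : Matrix r r ℂ)) * ω * (W ⊗ₖ (1 : Matrix r r ℂ)) =
      (Uᴴ * (W ⊗ₖ (1 : Matrix r r ℂ)))ᴴ * diagonal (fun i => (a i : ℂ)) *
        (Uᴴ * (W ⊗ₖ (1 : Matrix r r ℂ))) := by
    rw [conjTranspose_mul, conjTranspose_conjTranspose, conjTranspose_kronecker,
      conjTranspose_one]
    conv_lhs => rw [hω.eq]
    simp only [Matrix.mul_assoc]
  rw [h2] at h1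
  have h3 := congrFun (congrFun h1 j) j
  rw [diagonal_apply_eq, traceSnd, of_apply] at h3
  have h4 : ∀ k, ((Uᴴ * (W ⊗ₖ (1 : Matrix r r ℂ)))ᴴ * diagonal (fun i => (a i : ℂ)) *
      (Uᴴ * (W ⊗ₖ (1 : Matrix r r ℂ)))) (j, k) (j, k) =
      ((∑ i, ‖(Uᴴ * (W ⊗ₖ (1 : Matrix r r ℂ))) i (j, k)‖ ^ 2 * a i : ℝ) : ℂ) := by
    intro k
    rw [mul_apply]
    push_cast
    refine Finset.sum_congr rfl fun i _ => ?_
    rw [mul_diagonal, conjTranspose_apply, mul_right_comm, Complex.star_def, Complex.conj_mul']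
  simp only [h4] at h3
  exact_mod_cast h3

/-- The support of `ω` lies in that of `ω_B ⊗ 1`: nonnegative terms with sum `β j = 0` all vanish.
This makes the convention `log 0 = 0` harmless in the relative entropy. -/
theorem overlap_eq_zero_of_traceSnd (hρ : IsDensity ω) (hω : IsDiagonalization ω U a)
    (hB : IsDiagonalization (traceSnd ω) W β) (i j : b × r) (hj : β j.1 = 0) :
    ‖(Uᴴ * (W ⊗ₖ (1 : Matrix r r ℂ))) i j‖ ^ 2 * a i = 0 := by
  have h := sum_overlap_traceSnd hω hB j.1
  have hnn : ∀ k i, 0 ≤ ‖(Uᴴ * (W ⊗ₖ (1 : Matrix r r ℂ))) i (j.1, k)‖ ^ 2 * a i :=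
    fun k i => mul_nonneg (sq_nonneg _) (hω.nonneg hρ.1 i)
  rw [hj, Finset.sum_eq_zero_iff_of_nonneg
    fun k _ => Finset.sum_nonneg fun i _ => hnn k i] at h
  have h1 := h j.2 (Finset.mem_univ _)
  rw [Finset.sum_eq_zero_iff_of_nonneg fun i _ => hnn j.2 i] at h1
  exact h1 i (Finset.mem_univ _)

/-- The relative entropy of `ω` and `tr_R ω ⊗ 1` is minus the conditional entropy. -/
theorem klSum_traceSnd (hω : IsDiagonalization ω U a)
    (hB : IsDiagonalization (traceSnd ω) W β) :
    klSum (Uᴴ * (W ⊗ₖ (1 : Matrix r r ℂ))) a (fun i => β i.1) =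
      (entropy (traceSnd ω) - entropy ω) * log 2 := by
  have h2 : log 2 ≠ 0 := (log_pos one_lt_two).ne'
  rw [hω.entropy_eq, hB.entropy_eq, ← sub_div, div_mul_cancel₀ _ h2, klSum]
  simp only [mul_sub, Finset.sum_sub_distrib]
  rw [hω.sum_overlap_left hB.kronecker_one (fun i => a i * log (a i))]
  have h3 : ∑ i, ∑ j : b × r, ‖(Uᴴ * (W ⊗ₖ (1 : Matrix r r ℂ))) i j‖ ^ 2 *
      (a i * log (β j.1)) = ∑ j, β j * log (β j) := by
    rw [Finset.sum_comm, Fintype.sum_prod_type]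
    refine Finset.sum_congr rfl fun j _ => ?_
    refine Eq.trans ?_ (congrArg (· * log (β j)) (sum_overlap_traceSnd hω hB j))
    rw [Finset.sum_mul]
    refine Finset.sum_congr rfl fun k _ => ?_
    rw [Finset.sum_mul]
    exact Finset.sum_congr rfl fun i _ => (mul_assoc _ _ _).symm
  rw [h3]
  simp only [negMulLog, neg_mul, Finset.sum_neg_distrib]
  ring

/-- `S(BR) ≤ S(B) + log |R|`. -/
theorem entropy_le_entropy_traceSnd_add (hρ : IsDensity ω) [Nonempty r] :
    entropy ω ≤ entropy (traceSnd ω) + logb 2 (Fintype.card r) := by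
  obtain ⟨U, a, hω⟩ : ∃ U a, IsDiagonalization ω U a :=
    ⟨_, _, isDiagonalization_eigenvectorUnitary hρ.1.1⟩
  obtain ⟨W, β, hB⟩ : ∃ W β, IsDiagonalization (QChan.traceSnd ω) W β :=
    ⟨_, _, isDiagonalization_eigenvectorUnitary hρ.traceSnd.1.1⟩
  have h2 : 0 < log 2 := log_pos one_lt_two
  have hd : (0 : ℝ) < Fintype.card r := by exact_mod_cast Fintype.card_pos
  have hk := klSum_traceSnd hω hB
  -- Klein's inequality against the normalised state `ω_B ⊗ 1/|R|`, summed over all pairs of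
  -- eigenvectors.
  have hle := Finset.sum_le_sum fun i (_ : i ∈ Finset.univ) =>
    Finset.sum_le_sum fun j (_ : j ∈ Finset.univ) =>
      mul_log_sub_log_ge (sq_nonneg ‖(Uᴴ * (W ⊗ₖ (1 : Matrix r r ℂ))) i j‖)
        (hω.nonneg hρ.1 i) (hB.nonneg hρ.traceSnd.1 j.1) hd
        (overlap_eq_zero_of_traceSnd hρ hω hB i j)
  rw [← klSum, hk] at hle
  simp only [Finset.sum_sub_distrib, ← Finset.sum_div, ← Finset.sum_mul] at hle
  simp only [sum_norm_sq_row (hω.overlap_mul hB.kronecker_one), one_mul, hω.sum_eq_one hρ] at hle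
  rw [hω.sum_overlap_right hB.kronecker_one (fun j => β j.1),
    Fintype.sum_prod_type] at hle
  simp only [Finset.sum_const, Finset.card_univ, nsmul_eq_mul, ← Finset.mul_sum,
    hB.sum_eq_one hρ.traceSnd] at hle
  rw [mul_one, div_self hd.ne', sub_self, zero_sub] at hle
  rw [← sub_le_iff_le_add', logb, le_div_iff₀ h2]
  linarith

/-- Minus the conditional entropy is a convex function of the state. -/
theorem condEntropy_convex {ι : Type*} (s : Finset ι) {p : ι → ℝ} (hp : ∀ k ∈ s, 0 ≤ p k)
    {ω : ι → Matrix (b × r) (b × r) ℂ} (hω : ∀ k, IsDensity (ω k))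
    (h₀ : IsDensity (∑ k ∈ s, (p k : ℂ) • ω k)) :
    entropy (traceSnd (∑ k ∈ s, (p k : ℂ) • ω k)) - entropy (∑ k ∈ s, (p k : ℂ) • ω k) ≤
      ∑ k ∈ s, p k * (entropy (traceSnd (ω k)) - entropy (ω k)) := by
  have h2 : 0 < log 2 := log_pos one_lt_two
  have d := fun k => isDiagonalization_eigenvectorUnitary (hω k).1.1
  have dB := fun k => isDiagonalization_eigenvectorUnitary (hω k).traceSnd.1.1
  have d₀ := isDiagonalization_eigenvectorUnitary h₀.1.1
  have dB₀ := isDiagonalization_eigenvectorUnitary h₀.traceSnd.1.1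
  -- The second argument of the relative entropy mixes with the same weights, as joint convexity
  -- demands.
  have hkron : traceSnd (∑ k ∈ s, (p k : ℂ) • ω k) ⊗ₖ (1 : Matrix r r ℂ) =
      ∑ k ∈ s, (p k : ℂ) • (traceSnd (ω k) ⊗ₖ (1 : Matrix r r ℂ)) := by
    rw [traceSnd_sum_smul]
    ext i j
    simp [Matrix.sum_apply, Finset.sum_mul, mul_assoc]
  have hσ₀ := dB₀.kronecker_one (r := r)
  rw [hkron] at hσ₀
  have h := klSum_jointly_convex s hp d (fun k => (dB k).kronecker_one)
    (fun k => (d k).nonneg (hω k).1) (fun k j => (dB k).nonneg (hω k).traceSnd.1 j.1)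
    (fun k i j => overlap_eq_zero_of_traceSnd (hω k) (d k) (dB k) i j) d₀ hσ₀
    (d₀.nonneg h₀.1) (fun j => dB₀.nonneg h₀.traceSnd.1 j.1)
    (fun i j => overlap_eq_zero_of_traceSnd h₀ d₀ dB₀ i j)
  rw [klSum_traceSnd d₀ dB₀] at h
  simp only [klSum_traceSnd (d _) (dB _), ← mul_assoc, ← Finset.sum_mul] at h
  exact le_of_mul_le_mul_right h h2

end Partial

/-! ### The dimension bound on entropy -/

section Bound

/-- The entropy of a state on a `d`-dimensional space is at most `log₂ d`. -/
theorem entropy_le_logb_card {n : Type*} [Fintype n] [DecidableEq n] {ρ : Matrix n n ℂ}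
    (hρ : IsDensity ρ) : entropy ρ ≤ logb 2 (Fintype.card n) := by
  have hne : Nonempty n := by
    by_contra h
    rw [not_nonempty_iff] at h
    simpa [trace] using hρ.2
  -- Take `B` one-dimensional and let the whole space play the role of `R`.
  have hω := hρ.submatrix (Equiv.uniqueProd n Unit)
  have h := entropy_le_entropy_traceSnd_add hω
  rwa [entropy_submatrix _ hρ.1.1, entropy_eq_zero_of_unique hω.traceSnd, zero_add] at h

end Bound

end QChan

namespace QChan

open Matrix Real Kronecker

/-! ### Dilations and coherent information -/

section Dilation

variable {a b e e' r : Type*} [Fintype a] [Fintype b] [Fintype e] [Fintype e'] [Fintype r]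

/-- `V` is a (not necessarily isometric) Stinespring dilation of `Φ` with complement `Ψ`. -/
structure IsDilation (V : Matrix (b × e) a ℂ) (Φ : Matrix a a ℂ →ₗ[ℂ] Matrix b b ℂ)
    (Ψ : Matrix a a ℂ →ₗ[ℂ] Matrix e e ℂ) : Prop where
  eq_traceSnd : ∀ X, Φ X = traceSnd (V * X * Vᴴ)
  eq_traceFst : ∀ X, Ψ X = traceFst (V * X * Vᴴ)

theorem traceSnd_mul_mul_apply (V : Matrix (b × e) a ℂ) (X : Matrix a a ℂ) (i j : b) :
    traceSnd (V * X * Vᴴ) i j = ∑ k, ∑ l, X k l * ∑ x, V (i, x) k * star (V (j, x) l) := by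
  simp only [traceSnd, of_apply, mul_apply, conjTranspose_apply, Finset.sum_mul, Finset.mul_sum]
  rw [Finset.sum_comm]
  simp only [Finset.sum_comm (s := (Finset.univ : Finset e))]
  rw [Finset.sum_comm]
  exact Finset.sum_congr rfl fun _ _ => Finset.sum_congr rfl fun _ _ =>
    Finset.sum_congr rfl fun _ _ => by ring

theorem traceFst_mul_mul_apply (V : Matrix (b × e) a ℂ) (X : Matrix a a ℂ) (x y : e) :
    traceFst (V * X * Vᴴ) x y = ∑ k, ∑ l, X k l * ∑ i, V (i, x) k * star (V (i, y) l) :=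
  traceSnd_mul_mul_apply (V.submatrix Prod.swap id) X x y

theorem IsDensity.conj_isometry [DecidableEq a] {ρ : Matrix a a ℂ} (hρ : IsDensity ρ)
    {V : Matrix b a ℂ} (hV : Vᴴ * V = 1) : IsDensity (V * ρ * Vᴴ) :=
  ⟨hρ.1.mul_mul_conjTranspose_same V, by
    rw [trace_mul_comm, ← Matrix.mul_assoc, hV, Matrix.one_mul, hρ.2]⟩

theorem isDensity_fst_of_isDilation [DecidableEq a] {V : Matrix (b × e) a ℂ}
    {Φ : Matrix a a ℂ →ₗ[ℂ] Matrix b b ℂ} {Ψ : Matrix a a ℂ →ₗ[ℂ] Matrix e e ℂ}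
    (h : IsDilation V Φ Ψ) (hV : Vᴴ * V = 1) {ρ : Matrix a a ℂ} (hρ : IsDensity ρ) :
    IsDensity (Φ ρ) := by
  rw [h.eq_traceSnd]
  exact (hρ.conj_isometry hV).traceSnd

theorem isDensity_snd_of_isDilation [DecidableEq a] {V : Matrix (b × e) a ℂ}
    {Φ : Matrix a a ℂ →ₗ[ℂ] Matrix b b ℂ} {Ψ : Matrix a a ℂ →ₗ[ℂ] Matrix e e ℂ}
    (h : IsDilation V Φ Ψ) (hV : Vᴴ * V = 1) {ρ : Matrix a a ℂ} (hρ : IsDensity ρ) :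
    IsDensity (Ψ ρ) := by
  rw [h.eq_traceFst]
  exact (hρ.conj_isometry hV).traceFst

/-- The linear map `X ↦ tr_B (V X V†)`. -/
noncomputable def complementOf (V : Matrix (b × e) a ℂ) : Matrix a a ℂ →ₗ[ℂ] Matrix e e ℂ where
  toFun X := traceFst (V * X * Vᴴ)
  map_add' X Y := by
    ext i j
    simp [traceFst, Matrix.mul_add, Matrix.add_mul, Finset.sum_add_distrib]
  map_smul' c X := by
    ext i j
    simp [traceFst, Finset.mul_sum]

/-- Environments arise naturally on product or function types, whereas the capacity definitions ask
for `Fin m`; relabelling the environment basis bridges the two. -/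
theorem IsComplementary.reindex [DecidableEq a] {Φ : Matrix a a ℂ →ₗ[ℂ] Matrix b b ℂ}
    {Ψ : Matrix a a ℂ →ₗ[ℂ] Matrix e e ℂ} (h : IsComplementary Φ Ψ) (f : e' ≃ e) :
    ∃ Ψ' : Matrix a a ℂ →ₗ[ℂ] Matrix e' e' ℂ, IsComplementary Φ Ψ' := by
  obtain ⟨V, hV, h1, h2⟩ := h
  refine ⟨complementOf (V.submatrix (Prod.map id f) id), V.submatrix (Prod.map id f) id, ?_,
    fun X => ?_, fun X => rfl⟩
  · rw [← hV]
    ext i j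
    simp only [mul_apply, conjTranspose_apply, submatrix_apply, id]
    exact Equiv.sum_comp (Equiv.prodCongr (Equiv.refl b) f) fun x => star (V x i) * V x j
  · rw [h1]
    ext i j
    rw [traceSnd_mul_mul_apply, traceSnd_mul_mul_apply]
    refine Finset.sum_congr rfl fun k _ => Finset.sum_congr rfl fun l _ => ?_
    congr 1
    exact (Equiv.sum_comp f fun x => V (i, x) k * star (V (j, x) l)).symm

/-- `Φ` has a Stinespring dilation with a finite-dimensional environment. -/
noncomputable def HasComplement [DecidableEq a] (Φ : Matrix a a ℂ →ₗ[ℂ] Matrix b b ℂ) : Prop :=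
  ∃ (m : ℕ) (Ψ : Matrix a a ℂ →ₗ[ℂ] Matrix (Fin m) (Fin m) ℂ), IsComplementary Φ Ψ

theorem IsComplementary.hasComplement [DecidableEq a] {Φ : Matrix a a ℂ →ₗ[ℂ] Matrix b b ℂ}
    {Ψ : Matrix a a ℂ →ₗ[ℂ] Matrix e e ℂ} (h : IsComplementary Φ Ψ) : HasComplement Φ :=
  ⟨Fintype.card e, h.reindex (Fintype.equivFin e).symm⟩

theorem IsChannel.hasComplement [DecidableEq a] {Φ : Matrix a a ℂ →ₗ[ℂ] Matrix b b ℂ}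
    (h : IsChannel Φ) : HasComplement Φ := by
  obtain ⟨m, K, hK, hΦ⟩ := h
  refine ⟨m, complementOf (Matrix.of fun i k => K i.2 i.1 k),
    Matrix.of fun i k => K i.2 i.1 k, ?_, fun X => ?_, fun X => rfl⟩
  · rw [← hK]
    ext i j
    simp only [mul_apply, conjTranspose_apply, of_apply, Matrix.sum_apply,
      Fintype.sum_prod_type]
    exact Finset.sum_comm
  · ext i j
    simp only [hΦ, traceSnd, mul_apply, conjTranspose_apply, of_apply, Matrix.sum_apply]

end Dilation

/-! ### Coherent information through a reference system -/

section Choi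

variable {a b e r : Type*} [Fintype a] [Fintype b] [Fintype e] [Fintype r] [DecidableEq r]

/-- `(Φ ⊗ id)(|L⟩⟨L|)`, where `|L⟩` is the vectorisation of `L`. -/
noncomputable def choi (Φ : Matrix a a ℂ →ₗ[ℂ] Matrix b b ℂ) (L : Matrix a r ℂ) :
    Matrix (b × r) (b × r) ℂ :=
  Matrix.of fun i j => Φ (L * Matrix.single i.2 j.2 (1 : ℂ) * Lᴴ) i.1 j.1

theorem mul_single_mul_conjTranspose_apply (L : Matrix a r ℂ) (x y : r) (k l : a) :
    (L * Matrix.single x y (1 : ℂ) * Lᴴ) k l = L k x * star (L l y) := by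
  rw [mul_apply, Finset.sum_eq_single y]
  · simp
  · intro z _ hz
    rw [mul_single_apply_of_ne _ _ _ _ _ hz, zero_mul]
  · simp

theorem traceSnd_choi (Φ : Matrix a a ℂ →ₗ[ℂ] Matrix b b ℂ) (L : Matrix a r ℂ) :
    traceSnd (choi Φ L) = Φ (L * Lᴴ) := by
  have h : L * Lᴴ = ∑ x : r, (L * Matrix.single x x (1 : ℂ) : Matrix a r ℂ) * Lᴴ := by
    rw [← Matrix.sum_mul, ← Matrix.mul_sum, sum_single_one, Matrix.mul_one]
  rw [h, map_sum]
  ext i j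
  simp [traceSnd, choi, Matrix.sum_apply]

theorem choi_sum_smul {ι : Type*} (s : Finset ι) (p : ι → ℂ)
    (Φ : ι → Matrix a a ℂ →ₗ[ℂ] Matrix b b ℂ) (L : Matrix a r ℂ) :
    choi (∑ k ∈ s, p k • Φ k) L = ∑ k ∈ s, p k • choi (Φ k) L := by
  ext i j
  simp [choi, Matrix.sum_apply]

variable {V : Matrix (b × e) a ℂ} {Φ : Matrix a a ℂ →ₗ[ℂ] Matrix b b ℂ}
  {Ψ : Matrix a a ℂ →ₗ[ℂ] Matrix e e ℂ}

/-- `V * L` is a vector of `B ⊗ E ⊗ R`. Reshaped as a matrix `M` from E to BR, it has BR marginal `M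
Mᴴ` and, in `IsDilation.complement_eq`, E marginal `(Mᴴ M)ᵀ`. -/
theorem IsDilation.choi_eq (h : IsDilation V Φ Ψ) (L : Matrix a r ℂ) :
    choi Φ L = (Matrix.of fun (i : b × r) x => (V * L) (i.1, x) i.2) *
      (Matrix.of fun (i : b × r) x => (V * L) (i.1, x) i.2)ᴴ := by
  ext i j
  have h1 : V * (L * Matrix.single i.2 j.2 (1 : ℂ) * Lᴴ) * Vᴴ =
      (V * L) * Matrix.single i.2 j.2 (1 : ℂ) * (V * L)ᴴ := by
    simp only [conjTranspose_mul, Matrix.mul_assoc]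
  rw [choi, of_apply, h.eq_traceSnd, h1, traceSnd, of_apply, mul_apply]
  simp only [mul_single_mul_conjTranspose_apply, conjTranspose_apply, of_apply]

theorem IsDilation.complement_eq (h : IsDilation V Φ Ψ) (L : Matrix a r ℂ) :
    Ψ (L * Lᴴ) = ((Matrix.of fun (i : b × r) x => (V * L) (i.1, x) i.2)ᴴ *
      (Matrix.of fun (i : b × r) x => (V * L) (i.1, x) i.2))ᵀ := by
  have h1 : V * (L * Lᴴ) * Vᴴ = (V * L) * (V * L)ᴴ := by
    simp only [conjTranspose_mul, Matrix.mul_assoc]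
  ext x y
  rw [h.eq_traceFst, h1, transpose_apply]
  simp only [traceFst, of_apply, mul_apply (M := V * L), mul_apply (M := _ᴴ),
    conjTranspose_apply, Fintype.sum_prod_type, mul_comm]

theorem isDensity_choi [DecidableEq a] (h : IsDilation V Φ Ψ) (hV : Vᴴ * V = 1)
    {L : Matrix a r ℂ} (hL : IsDensity (L * Lᴴ)) : IsDensity (choi Φ L) := by
  refine ⟨?_, ?_⟩
  · rw [h.choi_eq]
    exact posSemidef_self_mul_conjTranspose _
  · rw [← (isDensity_fst_of_isDilation h hV hL).2, ← traceSnd_choi]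
    simp [traceSnd, trace, Fintype.sum_prod_type]

theorem HasComplement.isDensity_choi [DecidableEq a] (h : HasComplement Φ)
    {L : Matrix a r ℂ} (hL : IsDensity (L * Lᴴ)) : IsDensity (choi Φ L) := by
  obtain ⟨m, Ψ, V, hV, h1, h2⟩ := h
  exact QChan.isDensity_choi ⟨h1, h2⟩ hV hL

variable [DecidableEq b]

/-- `S(B) - S(BR)`. -/
noncomputable def coherentInfo (ω : Matrix (b × r) (b × r) ℂ) : ℝ :=
  entropy (traceSnd ω) - entropy ω

/-- The two marginals of the pure vector on BR and E have equal entropy. The left side does not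
mention the environment, so the value is independent of the chosen complement. -/
theorem IsDilation.coherentInfo_choi [DecidableEq e] (h : IsDilation V Φ Ψ)
    (L : Matrix a r ℂ) :
    coherentInfo (choi Φ L) = entropy (Φ (L * Lᴴ)) - entropy (Ψ (L * Lᴴ)) := by
  rw [coherentInfo, traceSnd_choi, h.complement_eq,
    entropy_transpose (isHermitian_conjTranspose_mul_self _), ← entropy_mul_conjTranspose,
    ← h.choi_eq]

variable [DecidableEq a]

theorem exists_eq_mul_conjTranspose {ρ : Matrix a a ℂ} (hρ : IsDensity ρ) :
    ∃ L : Matrix a a ℂ, ρ = L * Lᴴ := by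
  obtain ⟨U, d, h⟩ : ∃ U d, IsDiagonalization ρ U d :=
    ⟨_, _, isDiagonalization_eigenvectorUnitary hρ.1.1⟩
  refine ⟨U * diagonal fun i => ((√(d i) : ℝ) : ℂ), ?_⟩
  have h1 : diagonal (fun i => (d i : ℂ)) =
      diagonal (fun i => ((√(d i) : ℝ) : ℂ)) *
        (diagonal (fun i => ((√(d i) : ℝ) : ℂ)))ᴴ := by
    rw [diagonal_conjTranspose, diagonal_mul_diagonal]
    congr 1
    ext i
    have := Real.mul_self_sqrt (h.nonneg hρ.1 i)
    rw [Pi.star_apply, Complex.star_def, Complex.conj_ofReal]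
    exact_mod_cast this.symm
  have h2 := h.eq
  rw [h1] at h2
  rw [conjTranspose_mul]
  simpa only [Matrix.mul_assoc] using h2

theorem exists_choi_of_mem_coherentInfoValues {v : ℝ} (h : v ∈ coherentInfoValues Φ) :
    ∃ L : Matrix a a ℂ, IsDensity (L * Lᴴ) ∧ v = coherentInfo (choi Φ L) := by
  obtain ⟨m, Ψ, ρ, ⟨V, hV, h1, h2⟩, hρ, rfl⟩ := h
  obtain ⟨L, rfl⟩ := exists_eq_mul_conjTranspose hρ
  exact ⟨L, hρ, (IsDilation.coherentInfo_choi ⟨h1, h2⟩ L).symm⟩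

theorem HasComplement.coherentInfo_mem (h : HasComplement Φ) {L : Matrix a r ℂ}
    (hL : IsDensity (L * Lᴴ)) : coherentInfo (choi Φ L) ∈ coherentInfoValues Φ := by
  obtain ⟨m, Ψ, hΨ⟩ := h
  refine ⟨m, Ψ, _, hΨ, hL, ?_⟩
  obtain ⟨V, hV, h1, h2⟩ := hΨ
  exact IsDilation.coherentInfo_choi ⟨h1, h2⟩ L

theorem le_of_mem_coherentInfoValues {v : ℝ} (h : v ∈ coherentInfoValues Φ) :
    v ≤ logb 2 (Fintype.card b) := by
  obtain ⟨m, Ψ, ρ, ⟨V, hV, h1, h2⟩, hρ, rfl⟩ := h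
  have i1 := entropy_le_logb_card (isDensity_fst_of_isDilation ⟨h1, h2⟩ hV hρ)
  have i2 := entropy_nonneg (isDensity_snd_of_isDilation ⟨h1, h2⟩ hV hρ)
  linarith

theorem single_eq_mul_conjTranspose (k : a) : (Matrix.single k k 1 : Matrix a a ℂ) =
    (Matrix.single k () (1 : ℂ) : Matrix a Unit ℂ) * (Matrix.single k () (1 : ℂ))ᴴ := by
  simp [conjTranspose_single]

theorem isDensity_single (k : a) : IsDensity (Matrix.single k k 1 : Matrix a a ℂ) := by
  refine ⟨?_, by simp⟩
  rw [single_eq_mul_conjTranspose]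
  exact posSemidef_self_mul_conjTranspose _

theorem entropy_single (k : a) : entropy (Matrix.single k k 1 : Matrix a a ℂ) = 0 := by
  have h := isDensity_single k
  rw [single_eq_mul_conjTranspose] at h ⊢
  exact entropy_mul_conjTranspose_of_unique _ h

theorem HasComplement.coherentInfoValues_nonempty [Nonempty a] (h : HasComplement Φ) :
    (coherentInfoValues Φ).Nonempty := by
  obtain ⟨k⟩ := ‹Nonempty a›
  have hρ := isDensity_single k
  rw [single_eq_mul_conjTranspose] at hρ
  exact ⟨_, h.coherentInfo_mem hρ⟩

theorem HasComplement.isLUB_Q₁ [Nonempty a] (h : HasComplement Φ) :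
    IsLUB (coherentInfoValues Φ) (Q₁ Φ) :=
  isLUB_csSup h.coherentInfoValues_nonempty ⟨_, fun _ => le_of_mem_coherentInfoValues⟩

/-- The coherent information is convex in the channel. -/
theorem coherentInfo_choi_convex {ι : Type*} (s : Finset ι) {p : ι → ℝ}
    (hp : ∀ k ∈ s, 0 ≤ p k) {F : ι → Matrix a a ℂ →ₗ[ℂ] Matrix b b ℂ}
    (hF : ∀ k, HasComplement (F k)) (hΦ : HasComplement Φ)
    (h : Φ = ∑ k ∈ s, (p k : ℂ) • F k) {L : Matrix a r ℂ} (hL : IsDensity (L * Lᴴ)) :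
    coherentInfo (choi Φ L) ≤ ∑ k ∈ s, p k * coherentInfo (choi (F k) L) := by
  have h0 := hΦ.isDensity_choi hL
  rw [h, choi_sum_smul] at h0 ⊢
  exact condEntropy_convex s hp (fun k => (hF k).isDensity_choi hL) h0

end Choi

end QChan

namespace QChan

open Matrix Real Kronecker

/-! ### Tensor products of channels and the regularised capacity -/

section TensorFam

variable {a b e : Type*} [Fintype a] [Fintype b] [Fintype e] [DecidableEq a]

/-- The tensor product `⨂ₜ Φ t`. -/
noncomputable def tensorFam {n : ℕ} (Φ : Fin n → Matrix a a ℂ →ₗ[ℂ] Matrix b b ℂ) :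
    Matrix (Fin n → a) (Fin n → a) ℂ →ₗ[ℂ] Matrix (Fin n → b) (Fin n → b) ℂ where
  toFun X := Matrix.of fun i j =>
    ∑ k, ∑ l, X k l * ∏ t, Φ t (Matrix.single (k t) (l t) 1) (i t) (j t)
  map_add' X Y := by
    ext i j
    simp [add_mul, Finset.sum_add_distrib]
  map_smul' c X := by
    ext i j
    simp [Finset.mul_sum, mul_assoc]

theorem tensorFam_apply {n : ℕ} (Φ : Fin n → Matrix a a ℂ →ₗ[ℂ] Matrix b b ℂ)
    (X : Matrix (Fin n → a) (Fin n → a) ℂ) (i j : Fin n → b) :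
    tensorFam Φ X i j =
      ∑ k, ∑ l, X k l * ∏ t, Φ t (Matrix.single (k t) (l t) 1) (i t) (j t) := rfl

theorem tensorPow_eq_tensorFam (Φ : Matrix a a ℂ →ₗ[ℂ] Matrix b b ℂ) (n : ℕ) :
    tensorPow Φ n = tensorFam fun _ : Fin n => Φ := rfl

/-- The tensor product of a family of dilations. -/
noncomputable def tensorDilation {n : ℕ} (V : Fin n → Matrix (b × e) a ℂ) :
    Matrix ((Fin n → b) × (Fin n → e)) (Fin n → a) ℂ :=
  Matrix.of fun i k => ∏ t, V t (i.1 t, i.2 t) (k t)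

theorem isometry_tensorDilation {n : ℕ} {V : Fin n → Matrix (b × e) a ℂ}
    (hV : ∀ t, (V t)ᴴ * V t = 1) : (tensorDilation V)ᴴ * tensorDilation V = 1 := by
  ext k l
  have h1 : ∀ t, ∑ i, ∑ x, star (V t (i, x) (k t)) * V t (i, x) (l t) =
      (1 : Matrix a a ℂ) (k t) (l t) := by
    intro t
    rw [← hV t, mul_apply, Fintype.sum_prod_type]
    rfl
  have h2 : (1 : Matrix (Fin n → a) (Fin n → a) ℂ) k l =
      ∏ t, (1 : Matrix a a ℂ) (k t) (l t) := by
    by_cases h : k = l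
    · subst h
      simp
    · obtain ⟨t, ht⟩ := Function.ne_iff.1 h
      rw [one_apply_ne h]
      exact (Finset.prod_eq_zero (Finset.mem_univ t) (by exact one_apply_ne ht)).symm
  rw [h2]
  simp only [← h1, Finset.prod_univ_sum, Fintype.piFinset_univ]
  rw [mul_apply, Fintype.sum_prod_type]
  simp only [conjTranspose_apply, tensorDilation, of_apply, star_prod, Finset.prod_mul_distrib]

theorem IsDilation.single_fst {V : Matrix (b × e) a ℂ} {Φ : Matrix a a ℂ →ₗ[ℂ] Matrix b b ℂ}
    {Ψ : Matrix a a ℂ →ₗ[ℂ] Matrix e e ℂ} (h : IsDilation V Φ Ψ) (k l : a) (i j : b) :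
    Φ (Matrix.single k l 1) i j = ∑ x, V (i, x) k * star (V (j, x) l) := by
  rw [h.eq_traceSnd, traceSnd_mul_mul_apply, Finset.sum_eq_single k, Finset.sum_eq_single l]
  · simp
  · intro m _ hm
    simp [hm.symm]
  · simp
  · intro m _ hm
    simp [hm.symm]
  · simp

theorem IsDilation.single_snd {V : Matrix (b × e) a ℂ} {Φ : Matrix a a ℂ →ₗ[ℂ] Matrix b b ℂ}
    {Ψ : Matrix a a ℂ →ₗ[ℂ] Matrix e e ℂ} (h : IsDilation V Φ Ψ) (k l : a) (x y : e) :
    Ψ (Matrix.single k l 1) x y = ∑ i, V (i, x) k * star (V (i, y) l) := by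
  rw [h.eq_traceFst, traceFst_mul_mul_apply, Finset.sum_eq_single k, Finset.sum_eq_single l]
  · simp
  · intro m _ hm
    simp [hm.symm]
  · simp
  · intro m _ hm
    simp [hm.symm]
  · simp

theorem isDilation_tensorFam {n : ℕ} {V : Fin n → Matrix (b × e) a ℂ}
    {Φ : Fin n → Matrix a a ℂ →ₗ[ℂ] Matrix b b ℂ}
    {Ψ : Fin n → Matrix a a ℂ →ₗ[ℂ] Matrix e e ℂ} (h : ∀ t, IsDilation (V t) (Φ t) (Ψ t)) :
    IsDilation (tensorDilation V) (tensorFam Φ) (tensorFam Ψ) where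
  eq_traceSnd X := by
    ext i j
    rw [tensorFam_apply, traceSnd_mul_mul_apply]
    refine Finset.sum_congr rfl fun k _ => Finset.sum_congr rfl fun l _ => ?_
    simp only [(h _).single_fst, Finset.prod_univ_sum, Fintype.piFinset_univ, tensorDilation,
      of_apply, star_prod, Finset.prod_mul_distrib]
  eq_traceFst X := by
    ext i j
    rw [tensorFam_apply, traceFst_mul_mul_apply]
    refine Finset.sum_congr rfl fun k _ => Finset.sum_congr rfl fun l _ => ?_
    simp only [(h _).single_snd, Finset.prod_univ_sum, Fintype.piFinset_univ, tensorDilation,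
      of_apply, star_prod, Finset.prod_mul_distrib]

theorem IsComplementary.tensor {n : ℕ} {Φ : Fin n → Matrix a a ℂ →ₗ[ℂ] Matrix b b ℂ}
    {Ψ : Fin n → Matrix a a ℂ →ₗ[ℂ] Matrix e e ℂ} (h : ∀ t, IsComplementary (Φ t) (Ψ t)) :
    IsComplementary (tensorFam Φ) (tensorFam Ψ) := by
  choose V hV h1 h2 using h
  have h3 := isDilation_tensorFam fun t => (⟨h1 t, h2 t⟩ : IsDilation (V t) (Φ t) (Ψ t))
  exact ⟨tensorDilation V, isometry_tensorDilation hV, h3.eq_traceSnd, h3.eq_traceFst⟩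

theorem HasComplement.pow {Φ : Matrix a a ℂ →ₗ[ℂ] Matrix b b ℂ} (h : HasComplement Φ)
    (n : ℕ) : HasComplement (tensorPow Φ n) := by
  obtain ⟨m, Ψ, hΨ⟩ := h
  exact (IsComplementary.tensor fun _ : Fin n => hΨ).hasComplement

end TensorFam

/-! ### Superadditivity and existence of the regularised limit -/

section Superadditive

variable {a b r s : Type*} [Fintype a] [Fintype b] [Fintype r] [Fintype s] [DecidableEq a]
  [DecidableEq b] [DecidableEq r] [DecidableEq s]

theorem choi_apply (Φ : Matrix a a ℂ →ₗ[ℂ] Matrix b b ℂ) {n : ℕ}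
    (L : Matrix (Fin n → a) r ℂ) (i j : (Fin n → b) × r) :
    choi (tensorPow Φ n) L i j = ∑ k, ∑ l, L k i.2 * star (L l j.2) *
      ∏ t, Φ (Matrix.single (k t) (l t) 1) (i.1 t) (j.1 t) := by
  rw [choi, of_apply, tensorPow_eq_tensorFam, tensorFam_apply]
  simp only [mul_single_mul_conjTranspose_apply]

/-- The tensor product of two input amplitudes, on the joined index set. -/
noncomputable def appendInput {m n : ℕ} (L : Matrix (Fin m → a) r ℂ) (M : Matrix (Fin n → a) s ℂ) :
    Matrix (Fin (m + n) → a) (r × s) ℂ :=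
  (L ⊗ₖ M).submatrix (Fin.appendEquiv m n).symm id

/-- The reordering `(B^{m+n}) (R S) ≃ (B^m R) (B^n S)`. -/
noncomputable def appendOutputEquiv (b r s : Type*) (m n : ℕ) :
    (Fin (m + n) → b) × (r × s) ≃ ((Fin m → b) × r) × ((Fin n → b) × s) :=
  ((Fin.appendEquiv m n).symm.prodCongr (Equiv.refl _)).trans (Equiv.prodProdProdComm _ _ _ _)

theorem choi_appendInput (Φ : Matrix a a ℂ →ₗ[ℂ] Matrix b b ℂ) {m n : ℕ}
    (L : Matrix (Fin m → a) r ℂ) (M : Matrix (Fin n → a) s ℂ) :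
    choi (tensorPow Φ (m + n)) (appendInput L M) =
      (choi (tensorPow Φ m) L ⊗ₖ choi (tensorPow Φ n) M).submatrix
        (appendOutputEquiv b r s m n) (appendOutputEquiv b r s m n) := by
  ext i j
  rw [choi_apply, submatrix_apply, kroneckerMap_apply, choi_apply, choi_apply]
  rw [← (Fin.appendEquiv m n).sum_comp, Fintype.sum_prod_type, Finset.sum_mul_sum]
  refine Finset.sum_congr rfl fun k₁ _ => Finset.sum_congr rfl fun k₂ _ => ?_
  rw [← (Fin.appendEquiv m n).sum_comp, Fintype.sum_prod_type, Finset.sum_mul_sum]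
  refine Finset.sum_congr rfl fun l₁ _ => Finset.sum_congr rfl fun l₂ _ => ?_
  rw [Fin.prod_univ_add]
  simp only [appendInput, submatrix_apply, id, kroneckerMap_apply,
    star_mul', Fin.appendEquiv, Equiv.coe_fn_mk, Fin.append_left, Fin.append_right,
    appendOutputEquiv, Equiv.trans_apply, Equiv.prodCongr_apply, Prod.map_fst, Prod.map_snd,
    Equiv.prodProdProdComm_apply, Equiv.coe_fn_symm_mk, Equiv.refl_apply]
  ring

theorem appendInput_mul_conjTranspose {m n : ℕ}
    (L : Matrix (Fin m → a) r ℂ) (M : Matrix (Fin n → a) s ℂ) :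
    appendInput L M * (appendInput L M)ᴴ =
      ((L * Lᴴ) ⊗ₖ (M * Mᴴ)).submatrix (Fin.appendEquiv m n).symm (Fin.appendEquiv m n).symm := by
  rw [mul_kronecker_mul, ← conjTranspose_kronecker, appendInput, conjTranspose_submatrix,
    ← submatrix_mul _ _ _ _ _ Function.bijective_id]

theorem traceSnd_submatrix_append {m n : ℕ}
    (ω : Matrix ((Fin m → b) × r) ((Fin m → b) × r) ℂ)
    (τ : Matrix ((Fin n → b) × s) ((Fin n → b) × s) ℂ) :
    traceSnd ((ω ⊗ₖ τ).submatrix (appendOutputEquiv b r s m n) (appendOutputEquiv b r s m n)) =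
      (traceSnd ω ⊗ₖ traceSnd τ).submatrix (Fin.appendEquiv m n).symm
        (Fin.appendEquiv m n).symm := by
  ext i j
  simp only [traceSnd, of_apply, submatrix_apply, kroneckerMap_apply, Fintype.sum_prod_type,
    Finset.sum_mul_sum]
  rfl

theorem coherentInfo_appendInput {Φ : Matrix a a ℂ →ₗ[ℂ] Matrix b b ℂ} (hΦ : HasComplement Φ)
    {m n : ℕ} {L : Matrix (Fin m → a) r ℂ} {M : Matrix (Fin n → a) s ℂ}
    (hL : IsDensity (L * Lᴴ)) (hM : IsDensity (M * Mᴴ)) :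
    coherentInfo (choi (tensorPow Φ (m + n)) (appendInput L M)) =
      coherentInfo (choi (tensorPow Φ m) L) + coherentInfo (choi (tensorPow Φ n) M) := by
  have h1 := (hΦ.pow m).isDensity_choi hL
  have h2 := (hΦ.pow n).isDensity_choi hM
  rw [choi_appendInput, coherentInfo, traceSnd_submatrix_append,
    entropy_submatrix _ (h1.kronecker h2).1.1,
    entropy_submatrix _ (h1.traceSnd.kronecker h2.traceSnd).1.1, entropy_kronecker h1 h2,
    entropy_kronecker h1.traceSnd h2.traceSnd, coherentInfo, coherentInfo]
  ring

/-- The tensor product of two purified inputs is a purified input for the joint power, and coherent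
information is additive on it. -/
theorem Q₁_tensorPow_superadditive [Nonempty a] {Φ : Matrix a a ℂ →ₗ[ℂ] Matrix b b ℂ}
    (hΦ : HasComplement Φ) (m n : ℕ) :
    Q₁ (tensorPow Φ m) + Q₁ (tensorPow Φ n) ≤ Q₁ (tensorPow Φ (m + n)) := by
  have key : ∀ u ∈ coherentInfoValues (tensorPow Φ m),
      ∀ v ∈ coherentInfoValues (tensorPow Φ n), u + v ≤ Q₁ (tensorPow Φ (m + n)) := by
    intro u hu v hv
    obtain ⟨L, hL, rfl⟩ := exists_choi_of_mem_coherentInfoValues hu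
    obtain ⟨M, hM, rfl⟩ := exists_choi_of_mem_coherentInfoValues hv
    rw [← coherentInfo_appendInput hΦ hL hM]
    refine (hΦ.pow (m + n)).isLUB_Q₁.1 ((hΦ.pow (m + n)).coherentInfo_mem ?_)
    rw [appendInput_mul_conjTranspose]
    exact (hL.kronecker hM).submatrix _
  have h1 : Q₁ (tensorPow Φ m) ≤ Q₁ (tensorPow Φ (m + n)) - Q₁ (tensorPow Φ n) := by
    refine (hΦ.pow m).isLUB_Q₁.2 fun u hu => ?_
    have : Q₁ (tensorPow Φ n) ≤ Q₁ (tensorPow Φ (m + n)) - u :=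
      (hΦ.pow n).isLUB_Q₁.2 fun v hv => by linarith [key u hu v hv]
    linarith
  linarith

theorem HasQuantumCapacity.quantumCapacity_eq {Φ : Matrix a a ℂ →ₗ[ℂ] Matrix b b ℂ} {q : ℝ}
    (h : HasQuantumCapacity Φ q) : quantumCapacity Φ = q :=
  h.2.limUnder_eq

/-- The regularised capacity of a channel exists. -/
theorem HasComplement.hasQuantumCapacity [Nonempty a] {Φ : Matrix a a ℂ →ₗ[ℂ] Matrix b b ℂ}
    (hΦ : HasComplement Φ) : HasQuantumCapacity Φ (quantumCapacity Φ) := by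
  -- Fekete's lemma is applied to the negated sequence.
  have hsub : Subadditive fun n => -Q₁ (tensorPow Φ n) := fun m n => by
    linarith [Q₁_tensorPow_superadditive hΦ m n]
  have hub : ∀ n, Q₁ (tensorPow Φ n) ≤ n * logb 2 (Fintype.card b) := by
    intro n
    refine (hΦ.pow n).isLUB_Q₁.2 fun v hv => ?_
    refine (le_of_mem_coherentInfoValues hv).trans ?_
    rw [Fintype.card_fun, Fintype.card_fin, Nat.cast_pow, logb_pow]
  have hlog : 0 ≤ logb 2 (Fintype.card b) :=
    div_nonneg (log_natCast_nonneg _) (log_nonneg one_le_two)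
  have hbdd : BddBelow (Set.range fun n : ℕ => -Q₁ (tensorPow Φ n) / n) := by
    refine ⟨-logb 2 (Fintype.card b), ?_⟩
    rintro _ ⟨n, rfl⟩
    -- At `n = 0` the quotient is `0` by convention, so the lower bound must be nonpositive there.
    rcases n.eq_zero_or_pos with rfl | hn
    · simpa using hlog
    · have hn' : (0 : ℝ) < n := by exact_mod_cast hn
      simp only
      rw [le_div_iff₀ hn']
      linarith [hub n]
  have hlim := (hsub.tendsto_lim hbdd).neg
  simp only [neg_div, neg_neg] at hlim
  have h : HasQuantumCapacity Φ (-hsub.lim) :=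
    ⟨fun n => (hΦ.pow n).isLUB_Q₁, hlim⟩
  rwa [h.quantumCapacity_eq]

end Superadditive

end QChan

namespace QChan

open Matrix Real Kronecker

/-! ### Channels -/

section Channels

variable {a b e : Type*} [Fintype a] [Fintype b] [Fintype e] [DecidableEq a]

theorem IsChannel.convex {Φ Ψ : Matrix a a ℂ →ₗ[ℂ] Matrix b b ℂ} (hΦ : IsChannel Φ)
    (hΨ : IsChannel Ψ) {t : ℝ} (h0 : 0 ≤ t) (h1 : t ≤ 1) :
    IsChannel ((1 - (t : ℂ)) • Φ + (t : ℂ) • Ψ) := by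
  obtain ⟨m, K, hK, hΦ⟩ := hΦ
  obtain ⟨n, M, hM, hΨ⟩ := hΨ
  have e1 : ((√(1 - t) : ℝ) : ℂ) * ((√(1 - t) : ℝ) : ℂ) = 1 - t := by
    rw [← Complex.ofReal_mul, Real.mul_self_sqrt (by linarith)]
    simp
  have e2 : ((√t : ℝ) : ℂ) * ((√t : ℝ) : ℂ) = t := by
    rw [← Complex.ofReal_mul, Real.mul_self_sqrt h0]
  refine ⟨m + n, Fin.append (fun i => ((√(1 - t) : ℝ) : ℂ) • K i)
    (fun i => ((√t : ℝ) : ℂ) • M i), ?_, fun X => ?_⟩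
  · simp only [Fin.sum_univ_add, Fin.append_left, Fin.append_right, conjTranspose_smul,
      Complex.star_def, Complex.conj_ofReal, Matrix.smul_mul, Matrix.mul_smul, smul_smul, e1, e2,
      ← Finset.smul_sum, hK, hM]
    rw [← add_smul, sub_add_cancel, one_smul]
  · simp only [Fin.sum_univ_add, Fin.append_left, Fin.append_right, conjTranspose_smul,
      Complex.star_def, Complex.conj_ofReal, Matrix.smul_mul, Matrix.mul_smul, smul_smul, e1, e2,
      ← Finset.smul_sum, LinearMap.add_apply, LinearMap.smul_apply, hΦ, hΨ]

theorem isChannel_id : IsChannel (LinearMap.id : Matrix a a ℂ →ₗ[ℂ] Matrix a a ℂ) :=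
  ⟨1, fun _ => 1, by simp, fun X => by simp⟩

theorem isChannel_complementOf {m : ℕ} {V : Matrix (Fin m × e) a ℂ} (hV : Vᴴ * V = 1) :
    IsChannel (complementOf V) := by
  refine ⟨m, fun i => V.submatrix (fun x => (i, x)) id, ?_, fun X => ?_⟩
  · rw [← hV]
    ext k l
    simp [Matrix.sum_apply, mul_apply, Fintype.sum_prod_type]
  · ext x y
    simp [complementOf, traceFst, Matrix.sum_apply, mul_apply]

/-- The dilation of the identity channel with a trivial environment. -/
noncomputable def idDilation (a : Type*) [DecidableEq a] : Matrix (a × Fin 1) a ℂ :=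
  (1 : Matrix a a ℂ).submatrix Prod.fst id

theorem isComplementary_id :
    IsComplementary (LinearMap.id : Matrix a a ℂ →ₗ[ℂ] Matrix a a ℂ)
      (complementOf (idDilation a)) := by
  refine ⟨idDilation a, ?_, fun X => ?_, fun X => rfl⟩
  · have h : (idDilation a)ᴴ * idDilation a = (1 : Matrix a a ℂ)ᴴ * 1 := by
      ext k l
      rw [mul_apply, mul_apply, Fintype.sum_prod_type]
      exact Finset.sum_congr rfl fun i _ => Fintype.sum_unique _
    rw [h, conjTranspose_one, Matrix.one_mul]
  · ext k l
    simp [idDilation, mul_apply, traceSnd, one_apply]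

theorem isDegradable_id {m : ℕ} :
    IsDegradable (LinearMap.id : Matrix (Fin m) (Fin m) ℂ →ₗ[ℂ] Matrix (Fin m) (Fin m) ℂ) := by
  have h := isComplementary_id (a := Fin m)
  have hV := h
  obtain ⟨V, hV, h1, h2⟩ := h
  -- Unpacking the existential hides which `V` was used; its complement is nevertheless the same
  -- map. Since the channel is the identity, that complement is itself the degrading map.
  have e : complementOf (idDilation (Fin m)) = complementOf V := by
    ext X : 1
    exact h2 _
  exact ⟨1, _, _, isComplementary_id, e ▸ isChannel_complementOf hV, LinearMap.comp_id _⟩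

theorem entropy_smul_one [Nonempty a] :
    IsDensity ((Fintype.card a : ℂ)⁻¹ • (1 : Matrix a a ℂ)) ∧
      entropy ((Fintype.card a : ℂ)⁻¹ • (1 : Matrix a a ℂ)) = logb 2 (Fintype.card a) := by
  have hc : (Fintype.card a : ℝ) ≠ 0 := by exact_mod_cast Fintype.card_ne_zero
  have hc' : (Fintype.card a : ℂ) ≠ 0 := by exact_mod_cast Fintype.card_ne_zero
  have hd : IsDiagonalization ((Fintype.card a : ℂ)⁻¹ • (1 : Matrix a a ℂ)) 1
      (fun _ => (Fintype.card a : ℝ)⁻¹) :=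
    ⟨by simp, by simp, by ext i j; simp [one_apply]⟩
  refine ⟨⟨?_, ?_⟩, ?_⟩
  · refine PosSemidef.one.smul ?_
    simp
  · simp [hc']
  · rw [hd.entropy_eq, Finset.sum_const, Finset.card_univ, nsmul_eq_mul, negMulLog, log_inv, logb]
    field_simp

theorem isGreatest_coherentInfoValues_id [Nonempty a] :
    IsGreatest (coherentInfoValues (LinearMap.id : Matrix a a ℂ →ₗ[ℂ] Matrix a a ℂ))
      (logb 2 (Fintype.card a)) := by
  refine ⟨?_, fun v hv => le_of_mem_coherentInfoValues hv⟩
  obtain ⟨hρ, hS⟩ := entropy_smul_one (a := a)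
  refine ⟨1, _, _, isComplementary_id, hρ, ?_⟩
  obtain ⟨V, hV, h1, h2⟩ := isComplementary_id (a := a)
  rw [entropy_eq_zero_of_unique (isDensity_snd_of_isDilation ⟨h1, h2⟩ hV hρ), sub_zero,
    LinearMap.id_apply, hS]

/-- The value may be given through any complement; passing to the reference-system form allows `Φ`
itself to be used as the complement. -/
theorem eq_zero_of_mem_coherentInfoValues [DecidableEq b]
    {Φ : Matrix a a ℂ →ₗ[ℂ] Matrix b b ℂ} (hΦ : IsComplementary Φ Φ) {v : ℝ}
    (hv : v ∈ coherentInfoValues Φ) : v = 0 := by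
  obtain ⟨L, hL, rfl⟩ := exists_choi_of_mem_coherentInfoValues hv
  obtain ⟨V, hV, h1, h2⟩ := hΦ
  rw [IsDilation.coherentInfo_choi ⟨h1, h2⟩, sub_self]

theorem isGreatest_coherentInfoValues_of_selfComplementary [DecidableEq b] [Nonempty a]
    {Φ : Matrix a a ℂ →ₗ[ℂ] Matrix b b ℂ} (hΦ : IsComplementary Φ Φ) :
    IsGreatest (coherentInfoValues Φ) 0 := by
  refine ⟨?_, fun v hv => (eq_zero_of_mem_coherentInfoValues hΦ hv).le⟩
  obtain ⟨v, hv⟩ := hΦ.hasComplement.coherentInfoValues_nonempty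
  exact eq_zero_of_mem_coherentInfoValues hΦ hv ▸ hv

theorem hasQuantumCapacity_of_selfComplementary [DecidableEq b] [Nonempty a]
    {Φ : Matrix a a ℂ →ₗ[ℂ] Matrix b b ℂ} (hΦ : IsComplementary Φ Φ) :
    HasQuantumCapacity Φ 0 := by
  have h : ∀ n, Q₁ (tensorPow Φ n) = 0 := fun n =>
    (isGreatest_coherentInfoValues_of_selfComplementary
      (IsComplementary.tensor fun _ : Fin n => hΦ)).csSup_eq
  refine ⟨fun n => (hΦ.hasComplement.pow n).isLUB_Q₁, ?_⟩
  simp [h]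

end Channels

/-! ### The Landau–Streater channel -/

section LandauStreater

theorem landauStreater_eq (X : Matrix (Fin 3) (Fin 3) ℂ) :
    landauStreater X = (1 / 2 : ℂ) • (X.trace • (1 : Matrix (Fin 3) (Fin 3) ℂ) - X.transpose) := by
  have h : ∀ i j, landauStreater X i j =
      1 / 2 * ∑ k, ∑ l, (∑ m, spinOne k i m * X m l) * spinOne k l j := by
    intro i j
    simp only [landauStreater, LinearMap.coe_mk, AddHom.coe_mk, Matrix.smul_apply,
      Matrix.sum_apply, mul_apply, smul_eq_mul]
  ext i j
  rw [h]
  fin_cases i <;> fin_cases j <;>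
    simp [spinOne, Fin.sum_univ_three, trace, mul_right_comm Complex.I _ Complex.I] <;> ring

theorem conjTranspose_spinOne (k : Fin 3) : (spinOne k)ᴴ = spinOne k := by
  ext i j
  fin_cases k <;> fin_cases i <;> fin_cases j <;> simp [spinOne]

theorem sum_spinOne_mul_self : ∑ k, spinOne k * spinOne k = (2 : ℂ) • 1 := by
  ext i j
  fin_cases i <;> fin_cases j <;>
    simp [spinOne, Fin.sum_univ_three] <;> norm_num

/-- The entries are `-i ε_{ijk}`; this antisymmetry is the source of self-complementarity. -/
theorem spinOne_swap (i j k : Fin 3) : spinOne i j k = -spinOne j i k := by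
  fin_cases i <;> fin_cases j <;> fin_cases k <;> simp [spinOne]

theorem isComplementary_landauStreater : IsComplementary landauStreater landauStreater := by
  set c : ℂ := ((√2⁻¹ : ℝ) : ℂ) with hc
  have hcc : c * star c = 1 / 2 := by
    rw [hc, Complex.star_def, Complex.conj_ofReal, ← Complex.ofReal_mul,
      Real.mul_self_sqrt (by norm_num)]
    norm_num
  set V : Matrix (Fin 3 × Fin 3) (Fin 3) ℂ := Matrix.of fun i k => c * spinOne i.2 i.1 k with hV
  have hfst : ∀ X, landauStreater X = traceSnd (V * X * Vᴴ) := by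
    intro X
    have h1 : traceSnd (V * X * Vᴴ) = ∑ k, (c • spinOne k) * X * (c • spinOne k)ᴴ := by
      ext i j
      simp only [traceSnd, hV, of_apply, mul_apply, Matrix.sum_apply, conjTranspose_apply,
        Matrix.smul_apply, smul_eq_mul]
    rw [h1]
    simp only [conjTranspose_smul, conjTranspose_spinOne, Matrix.smul_mul, Matrix.mul_smul,
      smul_smul, hcc, mul_comm (star c), ← Finset.smul_sum]
    rfl
  refine ⟨V, ?_, hfst, fun X => ?_⟩
  · have h1 : Vᴴ * V = ∑ k, (c • spinOne k)ᴴ * (c • spinOne k) := by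
      ext i j
      rw [mul_apply, Fintype.sum_prod_type, Finset.sum_comm]
      simp only [hV, of_apply, mul_apply, Matrix.sum_apply, conjTranspose_apply,
        Matrix.smul_apply, smul_eq_mul]
    rw [h1]
    simp only [conjTranspose_smul, conjTranspose_spinOne, Matrix.smul_mul, Matrix.mul_smul,
      smul_smul, hcc, ← Finset.smul_sum, sum_spinOne_mul_self]
    norm_num
  -- Exchanging output and environment negates `V`; the sign squares away in `V X Vᴴ`, so both
  -- partial traces agree.
  · have hs : ∀ i k, V i.swap k = -V i k := by
      intro i k
      simp only [hV, of_apply, Prod.fst_swap, Prod.snd_swap, spinOne_swap i.1 i.2 k, mul_neg]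
    rw [hfst]
    ext x y
    rw [traceSnd_mul_mul_apply, traceFst_mul_mul_apply]
    refine Finset.sum_congr rfl fun k _ => Finset.sum_congr rfl fun l _ => ?_
    congr 1
    refine Finset.sum_congr rfl fun i _ => ?_
    have h1 := hs (i, x) k
    have h2 := hs (i, y) l
    rw [Prod.swap_prod_mk] at h1 h2
    rw [h1, h2, star_neg, neg_mul_neg]

theorem isChannel_landauStreater : IsChannel landauStreater := by
  obtain ⟨V, hV, h1, h2⟩ := isComplementary_landauStreater
  have : landauStreater = complementOf V := LinearMap.ext h2
  exact this ▸ isChannel_complementOf hV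

end LandauStreater

end QChan

namespace QChan

open Matrix Real Kronecker

/-! ### Mixtures with the identity channel -/

section Mixture

variable {a : Type*} [Fintype a] [DecidableEq a]

/-- The channel `X ↦ tr(X) |z⟩⟨z|`. -/
noncomputable def resetChannel (z : a) : Matrix a a ℂ →ₗ[ℂ] Matrix a a ℂ :=
  (traceLinearMap a ℂ ℂ).smulRight (Matrix.single z z 1)

/-- A redundant environment of type `a`, held in the state `z`, is used because
`IsComplementary.tensor` needs one environment type for all factors and a self-complementary `Λ` has
`a`. -/
theorem isComplementary_id_reset (z : a) :
    IsComplementary (LinearMap.id : Matrix a a ℂ →ₗ[ℂ] Matrix a a ℂ) (resetChannel z) := by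
  refine ⟨Matrix.of fun i k => if i.1 = k ∧ i.2 = z then 1 else 0, ?_, fun X => ?_, fun X => ?_⟩
  · ext k l
    rw [mul_apply, Fintype.sum_prod_type]
    simp only [conjTranspose_apply, of_apply, ite_and, apply_ite star, star_one, star_zero,
      mul_ite, mul_one, mul_zero]
    simp [one_apply, eq_comm]
  · ext i j
    rw [traceSnd_mul_mul_apply]
    simp [ite_and, apply_ite (starRingEnd ℂ)]
  · ext x y
    rw [traceFst_mul_mul_apply]
    by_cases hx : x = z
    · by_cases hy : y = z
      · subst hx hy
        simp [resetChannel, trace, apply_ite (starRingEnd ℂ)]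
      · simp [resetChannel, hy, Ne.symm hy]
    · simp [resetChannel, hx, Ne.symm hx]

/-- The channel acting as the identity on the factors in `S` and as `Λ` on the others. -/
noncomputable def partialFam (Λ : Matrix a a ℂ →ₗ[ℂ] Matrix a a ℂ) {n : ℕ} (S : Finset (Fin n)) :
    Fin n → Matrix a a ℂ →ₗ[ℂ] Matrix a a ℂ :=
  fun t => if t ∈ S then LinearMap.id else Λ

/-- The complement of `partialFam Λ S` when `Λ` is self-complementary. -/
noncomputable def partialFamCompl (Λ : Matrix a a ℂ →ₗ[ℂ] Matrix a a ℂ) (z : a) {n : ℕ}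
    (S : Finset (Fin n)) : Fin n → Matrix a a ℂ →ₗ[ℂ] Matrix a a ℂ :=
  fun t => if t ∈ S then resetChannel z else Λ

theorem isComplementary_partialFam {Λ : Matrix a a ℂ →ₗ[ℂ] Matrix a a ℂ}
    (hΛ : IsComplementary Λ Λ) (z : a) {n : ℕ} (S : Finset (Fin n)) :
    IsComplementary (tensorFam (partialFam Λ S)) (tensorFam (partialFamCompl Λ z S)) := by
  refine IsComplementary.tensor fun t => ?_
  by_cases h : t ∈ S
  · simpa [partialFam, partialFamCompl, h] using isComplementary_id_reset z
  · simpa [partialFam, partialFamCompl, h] using hΛ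

/-- Splitting the tensor factors into those in `S` and those outside. -/
noncomputable def splitEquiv (a : Type*) {n : ℕ} (S : Finset (Fin n)) :
    (Fin n → a) ≃ ({t // t ∈ S} → a) × ({t // t ∉ S} → a) :=
  Equiv.piEquivPiSubtypeProd (· ∈ S) fun _ => a

theorem tensorFam_split {n : ℕ} (Φ : Fin n → Matrix a a ℂ →ₗ[ℂ] Matrix a a ℂ)
    (S : Finset (Fin n)) (X : Matrix (Fin n → a) (Fin n → a) ℂ)
    (i j : ({t // t ∈ S} → a) × ({t // t ∉ S} → a)) :
    tensorFam Φ X ((splitEquiv a S).symm i) ((splitEquiv a S).symm j) =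
      ∑ k, ∑ l, X k l * ((∏ t : {t // t ∈ S}, Φ t (Matrix.single (k t) (l t) 1) (i.1 t) (j.1 t)) *
        ∏ t : {t // t ∉ S}, Φ t (Matrix.single (k t) (l t) 1) (i.2 t) (j.2 t)) := by
  rw [tensorFam_apply]
  refine Finset.sum_congr rfl fun k _ => Finset.sum_congr rfl fun l _ => ?_
  rw [← Fintype.prod_subtype_mul_prod_subtype (· ∈ S)]
  congr 1
  refine congrArg₂ (· * ·) (Finset.prod_congr (by ext; simp) fun t _ => ?_)
    (Finset.prod_congr rfl fun t _ => ?_) <;>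
  simp [splitEquiv, Equiv.piEquivPiSubtypeProd, t.2]

/-- On S the environment is reset, which amounts to tracing out the unchanged output there; off S
channel and complement apply the same `Λ`. So the environment state is a fixed pure state next to a
marginal of the output itself. -/
theorem tensorFam_partialFamCompl (Λ : Matrix a a ℂ →ₗ[ℂ] Matrix a a ℂ) (z : a) {n : ℕ}
    (S : Finset (Fin n)) (X : Matrix (Fin n → a) (Fin n → a) ℂ) :
    (tensorFam (partialFamCompl Λ z S) X).submatrix (splitEquiv a S).symm (splitEquiv a S).symm =
      (Matrix.single (fun _ => z) (fun _ => z) 1 : Matrix ({t // t ∈ S} → a) _ ℂ) ⊗ₖ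
        traceFst ((tensorFam (partialFam Λ S) X).submatrix (splitEquiv a S).symm
          (splitEquiv a S).symm) := by
  ext i j
  have hS : ∀ k l : Fin n → a, (∏ t : {t // t ∈ S},
      partialFamCompl Λ z S t (Matrix.single (k t) (l t) 1) (i.1 t) (j.1 t)) =
      (Matrix.single (fun _ => z) (fun _ => z) 1 : Matrix ({t // t ∈ S} → a) _ ℂ) i.1 j.1 *
        ∑ x : {t // t ∈ S} → a, ∏ t : {t // t ∈ S},
          partialFam Λ S t (Matrix.single (k t) (l t) 1) (x t) (x t) := by
    intro k l
    have h1 : (∑ x : {t // t ∈ S} → a, ∏ t : {t // t ∈ S},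
        partialFam Λ S t (Matrix.single (k t) (l t) 1) (x t) (x t)) =
        ∏ t : {t // t ∈ S}, (Matrix.single (k t) (l t) (1 : ℂ)).trace := by
      simp only [trace, Finset.prod_univ_sum, Fintype.piFinset_univ, diag_apply]
      refine Finset.sum_congr rfl fun x _ => Finset.prod_congr rfl fun t _ => ?_
      rw [partialFam, if_pos t.2, LinearMap.id_apply]
    have h2 : (Matrix.single (fun _ => z) (fun _ => z) 1 : Matrix ({t // t ∈ S} → a) _ ℂ)
        i.1 j.1 = ∏ t : {t // t ∈ S}, (Matrix.single z z (1 : ℂ)) (i.1 t) (j.1 t) := by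
      simp only [Matrix.single_apply]
      rw [Finset.prod_ite_zero]
      simp [funext_iff, forall_and]
    rw [h1, h2, ← Finset.prod_mul_distrib]
    refine Finset.prod_congr rfl fun t _ => ?_
    rw [partialFamCompl, if_pos t.2]
    simp [resetChannel, mul_comm]
  have hSc : ∀ k l : Fin n → a, (∏ t : {t // t ∉ S},
      partialFamCompl Λ z S t (Matrix.single (k t) (l t) 1) (i.2 t) (j.2 t)) =
      ∏ t : {t // t ∉ S}, partialFam Λ S t (Matrix.single (k t) (l t) 1) (i.2 t) (j.2 t) :=
    fun k l => Finset.prod_congr rfl fun t _ => by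
      rw [partialFamCompl, partialFam, if_neg t.2, if_neg t.2]
  rw [submatrix_apply, tensorFam_split, kroneckerMap_apply, traceFst, of_apply]
  simp only [submatrix_apply, tensorFam_split, hS, hSc]
  simp only [Finset.mul_sum, Finset.sum_mul]
  conv_rhs => rw [Finset.sum_comm]
  refine Finset.sum_congr rfl fun k _ => ?_
  conv_rhs => rw [Finset.sum_comm]
  refine Finset.sum_congr rfl fun l _ => Finset.sum_congr rfl fun x _ => ?_
  ring

/-- The environment entropy equals `S(B_{Sᶜ})`, so only `S(B) ≤ S(B_{Sᶜ}) + log |B_S|` is needed. -/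
theorem coherentInfo_partialFam_le [Nonempty a] {Λ : Matrix a a ℂ →ₗ[ℂ] Matrix a a ℂ}
    (hΛ : IsComplementary Λ Λ) {n : ℕ} (S : Finset (Fin n)) {r : Type*} [Fintype r]
    [DecidableEq r] {L : Matrix (Fin n → a) r ℂ} (hL : IsDensity (L * Lᴴ)) :
    coherentInfo (choi (tensorFam (partialFam Λ S)) L) ≤
      S.card * logb 2 (Fintype.card a) := by
  obtain ⟨z⟩ := ‹Nonempty a›
  obtain ⟨V, hV, h1, h2⟩ := isComplementary_partialFam hΛ z S
  have hdil : IsDilation V _ _ := ⟨h1, h2⟩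
  rw [hdil.coherentInfo_choi]
  have d1 := (isDensity_fst_of_isDilation hdil hV hL).submatrix (splitEquiv a S).symm
  have d2 := isDensity_snd_of_isDilation hdil hV hL
  have e1 := entropy_submatrix (splitEquiv a S).symm d2.1.1
  rw [tensorFam_partialFamCompl, entropy_kronecker (isDensity_single _) d1.traceFst,
    entropy_single, zero_add] at e1
  have d3 := d1.submatrix (Equiv.prodComm ({t // t ∉ S} → a) ({t // t ∈ S} → a))
  have : Nonempty ({t // t ∈ S} → a) := ⟨fun _ => z⟩
  have e2 := entropy_le_entropy_traceSnd_add d3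
  rw [entropy_submatrix _ d1.1.1,
    entropy_submatrix _ (isDensity_fst_of_isDilation hdil hV hL).1.1] at e2
  have e3 : traceSnd (((tensorFam (partialFam Λ S) (L * Lᴴ)).submatrix (splitEquiv a S).symm
      (splitEquiv a S).symm).submatrix (Equiv.prodComm ({t // t ∉ S} → a) ({t // t ∈ S} → a))
        (Equiv.prodComm ({t // t ∉ S} → a) ({t // t ∈ S} → a))) =
      traceFst ((tensorFam (partialFam Λ S) (L * Lᴴ)).submatrix (splitEquiv a S).symm
      (splitEquiv a S).symm) := rfl
  rw [e3, e1, Fintype.card_fun, Fintype.card_coe, Nat.cast_pow, logb_pow] at e2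
  linarith

theorem tensorPow_mixture (Λ : Matrix a a ℂ →ₗ[ℂ] Matrix a a ℂ) (x : ℝ) (n : ℕ) :
    tensorPow ((1 - (x : ℂ)) • LinearMap.id + (x : ℂ) • Λ) n =
      ∑ S : Finset (Fin n), (((1 - x) ^ S.card * x ^ (n - S.card) : ℝ) : ℂ) •
        tensorFam (partialFam Λ S) := by
  refine LinearMap.ext fun X => ?_
  ext i j
  have hprod : ∀ k l : Fin n → a,
      ∏ t, ((1 - (x : ℂ)) • LinearMap.id + (x : ℂ) • Λ : Matrix a a ℂ →ₗ[ℂ] Matrix a a ℂ)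
        (Matrix.single (k t) (l t) 1) (i t) (j t) =
        ∑ S : Finset (Fin n), (((1 - x) ^ S.card * x ^ (n - S.card) : ℝ) : ℂ) *
          ∏ t, partialFam Λ S t (Matrix.single (k t) (l t) 1) (i t) (j t) := by
    intro k l
    simp only [LinearMap.add_apply, LinearMap.smul_apply, LinearMap.id_apply, Matrix.add_apply,
      Matrix.smul_apply, smul_eq_mul]
    -- Multiplying out the product of sums: S records the factors where the identity term is chosen.
    rw [Finset.prod_add, Finset.powerset_univ]
    refine Finset.sum_congr rfl fun S _ => ?_
    rw [← Finset.prod_mul_prod_compl S, ← Finset.compl_eq_univ_sdiff]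
    have e1 : ∏ t ∈ S, partialFam Λ S t (Matrix.single (k t) (l t) 1) (i t) (j t) =
        ∏ t ∈ S, (Matrix.single (k t) (l t) (1 : ℂ)) (i t) (j t) :=
      Finset.prod_congr rfl fun t ht => by rw [partialFam, if_pos ht, LinearMap.id_apply]
    have e2 : ∏ t ∈ Sᶜ, partialFam Λ S t (Matrix.single (k t) (l t) 1) (i t) (j t) =
        ∏ t ∈ Sᶜ, Λ (Matrix.single (k t) (l t) (1 : ℂ)) (i t) (j t) :=
      Finset.prod_congr rfl fun t ht => by
        rw [partialFam, if_neg (Finset.mem_compl.1 ht)]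
    rw [e1, e2, Finset.prod_mul_distrib, Finset.prod_mul_distrib, Finset.prod_const,
      Finset.prod_const, Finset.card_compl, Fintype.card_fin]
    push_cast
    ring
  rw [tensorPow_eq_tensorFam, tensorFam_apply]
  simp only [hprod, LinearMap.sum_apply, LinearMap.smul_apply, Matrix.sum_apply,
    Matrix.smul_apply, tensorFam_apply, smul_eq_mul, Finset.mul_sum]
  conv_rhs => rw [Finset.sum_comm]
  refine Finset.sum_congr rfl fun k _ => ?_
  conv_rhs => rw [Finset.sum_comm]
  refine Finset.sum_congr rfl fun l _ => Finset.sum_congr rfl fun S _ => ?_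
  ring

/-- The mean of a binomial variable with success probability `1 - x`, read off from the first-moment
identity of the Bernstein polynomials after grouping subsets by size. -/
theorem sum_card_binomial (x : ℝ) (n : ℕ) :
    ∑ S : Finset (Fin n), (1 - x) ^ S.card * x ^ (n - S.card) * S.card = n * (1 - x) := by
  have h := congrArg (Polynomial.eval (1 - x)) (bernsteinPolynomial.sum_smul ℝ n)
  rw [Polynomial.eval_finsetSum, Polynomial.eval_smul, Polynomial.eval_X, nsmul_eq_mul] at h
  rw [← h, ← Finset.powerset_univ,
    Finset.sum_powerset_apply_card fun m => (1 - x) ^ m * x ^ (n - m) * (m : ℝ),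
    Finset.card_univ, Fintype.card_fin]
  refine Finset.sum_congr rfl fun m _ => ?_
  simp [bernsteinPolynomial]
  ring

/-- Convexity in the channel is used at a fixed purified input; the component bounds do not depend
on that input and average to the binomial mean. -/
theorem Q₁_tensorPow_mixture_le [Nonempty a] {Λ : Matrix a a ℂ →ₗ[ℂ] Matrix a a ℂ}
    (hΛ : IsComplementary Λ Λ) {x : ℝ} (h0 : 0 ≤ x) (h1 : x ≤ 1)
    (hM : HasComplement ((1 - (x : ℂ)) • LinearMap.id + (x : ℂ) • Λ)) (n : ℕ) :
    Q₁ (tensorPow ((1 - (x : ℂ)) • LinearMap.id + (x : ℂ) • Λ) n) ≤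
      n * ((1 - x) * logb 2 (Fintype.card a)) := by
  refine (hM.pow n).isLUB_Q₁.2 fun v hv => ?_
  obtain ⟨L, hL, rfl⟩ := exists_choi_of_mem_coherentInfoValues hv
  obtain ⟨z⟩ := ‹Nonempty a›
  have hp : ∀ S ∈ (Finset.univ : Finset (Finset (Fin n))),
      0 ≤ (1 - x) ^ S.card * x ^ (n - S.card) := fun S _ =>
    mul_nonneg (pow_nonneg (by linarith) _) (pow_nonneg h0 _)
  refine (coherentInfo_choi_convex Finset.univ hp
    (fun S => (isComplementary_partialFam hΛ z S).hasComplement) (hM.pow n)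
    (tensorPow_mixture Λ x n) hL).trans ?_
  rw [← mul_assoc, ← sum_card_binomial, Finset.sum_mul]
  refine Finset.sum_le_sum fun S hS => ?_
  rw [mul_assoc _ (S.card : ℝ)]
  exact mul_le_mul_of_nonneg_left
    (haveI : Nonempty a := ⟨z⟩; coherentInfo_partialFam_le hΛ S hL) (hp S hS)

theorem quantumCapacity_mixture_le [Nonempty a] {Λ : Matrix a a ℂ →ₗ[ℂ] Matrix a a ℂ}
    (hΛ : IsComplementary Λ Λ) {x : ℝ} (h0 : 0 ≤ x) (h1 : x ≤ 1)
    (hM : HasComplement ((1 - (x : ℂ)) • LinearMap.id + (x : ℂ) • Λ)) :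
    quantumCapacity ((1 - (x : ℂ)) • LinearMap.id + (x : ℂ) • Λ) ≤
      (1 - x) * logb 2 (Fintype.card a) := by
  refine le_of_tendsto hM.hasQuantumCapacity.2 ?_
  filter_upwards [eventually_gt_atTop 0] with n hn
  have hn' : (0 : ℝ) < n := by exact_mod_cast hn
  rw [div_le_iff₀' hn']
  exact Q₁_tensorPow_mixture_le hΛ h0 h1 hM n

end Mixture

end QChan
-- The main theorem
open QChan in
theorem mainTheorem3 (x : ℝ) (hx0 : 0 ≤ x) (hx1 : x ≤ 1) :
    -- the convex decomposition, with the Werner-Holevo form of the second component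
    (IsChannel (noisyLandauStreater x) ∧
      noisyLandauStreater x = (1 - (x : ℂ)) • idChannel + (x : ℂ) • landauStreater ∧
      ∀ X, landauStreater X = (1 / 2 : ℂ) • (X.trace • (1 : Matrix (Fin 3) (Fin 3) ℂ) - X.transpose)) ∧
    -- both components are degradable channels; the second one is its own complement
    (IsChannel idChannel ∧ IsDegradable idChannel ∧
      IsChannel landauStreater ∧ IsDegradable landauStreater ∧
      IsComplementary landauStreater landauStreater ∧ IsAntidegradable landauStreater) ∧
    -- the second component has zero capacity
    (IsGreatest (coherentInfoValues landauStreater) (Q₁ landauStreater) ∧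
      Q₁ landauStreater = 0 ∧
      HasQuantumCapacity landauStreater (quantumCapacity landauStreater) ∧
      quantumCapacity landauStreater = 0) ∧
    -- the single-letter value of the identity channel
    (IsGreatest (coherentInfoValues idChannel) (Q₁ idChannel) ∧
      Q₁ idChannel = Real.logb 2 3) ∧
    -- the capacity bound
    (HasQuantumCapacity (noisyLandauStreater x) (quantumCapacity (noisyLandauStreater x)) ∧
      quantumCapacity (noisyLandauStreater x) ≤
        (1 - x) * Q₁ idChannel + x * Q₁ landauStreater ∧
      (1 - x) * Q₁ idChannel + x * Q₁ landauStreater = (1 - x) * Q₁ idChannel ∧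
      (1 - x) * Q₁ idChannel = (1 - x) * Real.logb 2 3) := by
  have hΛ := isComplementary_landauStreater
  -- Self-complementarity lets the identity serve as both degrading and anti-degrading map.
  have hdeg : IsDegradable landauStreater :=
    ⟨3, landauStreater, LinearMap.id, hΛ, isChannel_id, LinearMap.id_comp _⟩
  have hanti : IsAntidegradable landauStreater :=
    ⟨3, landauStreater, LinearMap.id, hΛ, isChannel_id, LinearMap.id_comp _⟩
  have hch : IsChannel (noisyLandauStreater x) :=
    isChannel_id.convex isChannel_landauStreater hx0 hx1
  have hG1 := isGreatest_coherentInfoValues_of_selfComplementary hΛ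
  have hQ1 : Q₁ landauStreater = 0 := hG1.csSup_eq
  have hG0 : IsGreatest (coherentInfoValues idChannel) (Real.logb 2 3) := by
    simpa [idChannel] using isGreatest_coherentInfoValues_id (a := Fin 3)
  have hQ0 : Q₁ idChannel = Real.logb 2 3 := hG0.csSup_eq
  have hcap : quantumCapacity landauStreater = 0 :=
    (hasQuantumCapacity_of_selfComplementary hΛ).quantumCapacity_eq
  have hle : quantumCapacity (noisyLandauStreater x) ≤ (1 - x) * Real.logb 2 3 := by
    simpa [noisyLandauStreater] using quantumCapacity_mixture_le hΛ hx0 hx1 hch.hasComplement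
  refine ⟨⟨hch, rfl, landauStreater_eq⟩,
    ⟨isChannel_id, isDegradable_id, isChannel_landauStreater, hdeg, hΛ, hanti⟩,
    ⟨hQ1.symm ▸ hG1, hQ1, hΛ.hasComplement.hasQuantumCapacity, hcap⟩,
    ⟨hQ0.symm ▸ hG0, hQ0⟩,
    ⟨hch.hasComplement.hasQuantumCapacity, ?_, ?_, ?_⟩⟩
  · rwa [hQ0, hQ1, mul_zero, add_zero]
  · rw [hQ1, mul_zero, add_zero]
  · rw [hQ0]
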